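/- Let $d\ge 3$, let $Q$ be a positive definite quadratic form on $\mathbb R^{d-1}$ with real symmetric coefficient matrix $A=(a_{ij})$ (so $Q(\vec x)=\sum_{i,j}a_{ij}x_ix_j$), and suppose that $a_{12}/a_{11}\in\mathbb Q$ and $a_{22}/a_{11}\in\mathbb Q$. For $c>0$ and $\vec\beta\in\mathbb R^{d-1}$ put \[ \mathcal P=\{(\vec x,y)\in\mathbb R^{d-1}\times\mathbb R : |y|\le c-Q(\vec x+\vec\beta)\}, \] let $|\mathcal P|$ be its volume, and for $R>0$ let $\mathcal N(R)=\#\{\vec n\in\mathbb Z^d : R^{-1}\vec n\in\mathcal P\}$. Then for every $\epsilon>0$ \[ \mathcal N(R)=|\mathcal P|R^d+O\big(R^{d-2+\epsilon}\big) \] holds uniformly for $0<c\ll 1<R$ and $\vec\beta\in\mathbb R^{d-1}$; that is, for every $c_0>0$ there is a constant $C$, depending only on $d$, $Q$, $\epsilon$ and $c_0$, such that \[ \big|\mathcal N(R)-|\mathcal P|R^d\big|\le C\,R^{d-2+\epsilon} \] for all $0<c\le c_0$, all $R>1$ and all $\vec\beta\in\mathbb R^{d-1}$. -/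

import Mathlib

open MeasureTheory

noncomputable section

/-- The region `{(x, y) ∈ ℝᵐ × ℝ : |y| ≤ c - Q(x + β)}`, where `Q` is a quadratic form on `ℝᵐ`. -/
def paraboloid {m : ℕ} (Q : QuadraticForm ℝ (Fin m → ℝ)) (c : ℝ) (β : Fin m → ℝ) :
    Set ((Fin m → ℝ) × ℝ) :=
  {p | |p.2| ≤ c - Q (p.1 + β)}

/-- The integral points `n ∈ ℤᵐ × ℤ` with `R⁻¹ n ∈ K`. -/
def latticePoints {m : ℕ} (K : Set ((Fin m → ℝ) × ℝ)) (R : ℝ) : Set ((Fin m → ℤ) × ℤ) :=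
  {n | R⁻¹ • ((fun i => (n.1 i : ℝ), (n.2 : ℝ)) : (Fin m → ℝ) × ℝ) ∈ K}

/-- The number of integral points `n` with `R⁻¹ n ∈ K` (for bounded `K` and `R ≠ 0`
this is the cardinality of a finite set). -/
def latticeCount {m : ℕ} (K : Set ((Fin m → ℝ) × ℝ)) (R : ℝ) : ℕ :=
  (latticePoints K R).ncard

/-- The (symmetric) coefficient matrix `A = (a i j)` of `Q`, so that `Q x = ∑ i j, a i j * x i * x j`. -/
def coeffMatrix {m : ℕ} (Q : QuadraticForm ℝ (Fin m → ℝ)) : Matrix (Fin m) (Fin m) ℝ :=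
  QuadraticForm.toMatrix' Q

end

/-! Put `X = c * R ^ 2`. Over an integral point `n` of the base, the admissible heights are the
integers of `[-s, s]` with `s = (X - Q (n + R • β)) / R`, and there are `2 * ⌊s⌋ + 1 = 2 * s - 2 *
(fract s - 1 / 2)` of them. The count is therefore `2 / R` times the Riesz mean `∑ (X - Q (n + R •
β))`, minus twice a sawtooth sum, both over the ellipsoid `Q ≤ X` (`latticeCount_paraboloid`).

The Riesz mean differs from its integral by `O(R ^ (d - 1))` (`riesz_mean_le`). Averaging over the
unit cube and its reflection leaves only second differences of `max 0 (X - Q)`. These are `O(1)`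
except in a boundary shell of bounded width, where they are `O(R)` at `O(R ^ (d - 2))` points. The
integral rescales to the volume term.

The sawtooth sum has to be `O(R ^ (d - 2 + ε))` (`sawtooth_sum_le`). Fixing the last `d - 3`
coordinates leaves `O(R ^ (d - 3))` planes. Since `a₁₂ / a₁₁ = p / q` is rational, a shear together
with a splitting modulo `q` makes the form diagonal in two integer variables on each plane. A bound
`O(R ^ (1 + ε))` for binary diagonal forms remains (`binary_sawtooth_sum_le`).

For these, the sharp cutoff `t ≤ X` is replaced by a Gaussian smoothing on the scale `R`, at a cost
`O(R)`. The sawtooth is expanded in frequencies `h / R` and the cutoff in frequencies `τ`. What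
appears are complete sums over a box, which factor into one-variable quadratic sums. By Weyl
differencing the squares of these are at most `L` plus a sum over `k` of spikes at `2 * A * (τ - h /
R) * k`. The saving comes from averaging over `h` and `τ` (`sum_integral_weyl_le`): after `u = k *
τ` the phase is `2 * A * u - 2 * A * h * k / R`, which depends on `h` and `k` only through `h * k`.
The divisor bound then reduces everything to progressions of step `2 * A / R`, of which `O(R)`
consecutive terms wind around the circle `O(1)` times. No estimate depends on the shifts, whence the
uniformity in `β`. -/

noncomputable section

/-! ### Exponential sums and Weyl differencing -/

/-- The additive character `x ↦ exp (2πix)` of the real line. -/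
def unitExp (x : ℝ) : ℂ := Complex.exp (2 * Real.pi * x * Complex.I)

lemma unitExp_add (x y : ℝ) : unitExp (x + y) = unitExp x * unitExp y := by
  simp only [unitExp, ← Complex.exp_add]
  push_cast
  ring_nf

lemma norm_unitExp (x : ℝ) : ‖unitExp x‖ = 1 := by
  have : (2 * Real.pi * x * Complex.I : ℂ) = ((2 * Real.pi * x : ℝ) : ℂ) * Complex.I := by
    push_cast; ring
  rw [unitExp, this, Complex.norm_exp_ofReal_mul_I]

lemma continuous_unitExp : Continuous unitExp := by
  unfold unitExp; fun_prop

lemma conj_unitExp (x : ℝ) : (starRingEnd ℂ) (unitExp x) = unitExp (-x) := by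
  simp [unitExp, ← Complex.exp_conj, map_ofNat]

lemma unitExp_nat_mul (n : ℕ) (x : ℝ) : unitExp (n * x) = unitExp x ^ n := by
  simp only [unitExp, ← Complex.exp_nat_mul]
  push_cast
  ring_nf

lemma norm_unitExp_sub_one (x : ℝ) : ‖unitExp x - 1‖ = 2 * |Real.sin (Real.pi * x)| := by
  have h := Complex.norm_exp_I_mul_ofReal_sub_one (2 * Real.pi * x)
  have h2 : unitExp x = Complex.exp (Complex.I * ((2 * Real.pi * x : ℝ) : ℂ)) := by
    rw [unitExp]; push_cast; ring_nf
  rw [h2, h, Real.norm_eq_abs, abs_mul, abs_two]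
  ring_nf

lemma norm_unitExp_sub_one_le (x : ℝ) : ‖unitExp x - 1‖ ≤ 2 * Real.pi * |x| := by
  rw [norm_unitExp_sub_one]
  have h : |Real.sin (Real.pi * x)| ≤ |Real.pi * x| := Real.abs_sin_le_abs
  rw [abs_mul, abs_of_pos Real.pi_pos] at h
  linarith

/-- The distance from a real number to the nearest integer. -/
def distInt (x : ℝ) : ℝ := ‖(x : UnitAddCircle)‖

lemma distInt_eq (x : ℝ) : distInt x = |x - round x| := UnitAddCircle.norm_eq

lemma distInt_nonneg (x : ℝ) : 0 ≤ distInt x := norm_nonneg _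

lemma distInt_le_half (x : ℝ) : distInt x ≤ 1 / 2 := by
  rw [distInt_eq]; exact abs_sub_round x

lemma continuous_distInt : Continuous distInt := by
  unfold distInt
  exact continuous_norm.comp (AddCircle.continuous_mk' 1)

lemma distInt_neg (x : ℝ) : distInt (-x) = distInt x := by
  simp [distInt]

/-- Jordan's inequality `2 / π * y ≤ sin y` on `[0, π / 2]`, after subtracting the nearest integer.
-/
lemma four_mul_distInt_le (x : ℝ) : 4 * distInt x ≤ ‖unitExp x - 1‖ := by
  rw [norm_unitExp_sub_one, distInt_eq]
  set r := x - round x with hr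
  have hr2 : |r| ≤ 1 / 2 := abs_sub_round x
  have h1 : |Real.sin (Real.pi * x)| = |Real.sin (Real.pi * r)| := by
    have : Real.pi * r = Real.pi * x - (round x : ℤ) * Real.pi := by rw [hr]; ring
    rw [this, Real.sin_sub_int_mul_pi, abs_mul, abs_zpow]
    simp
  have h2 : |Real.sin (Real.pi * r)| = |Real.sin (Real.pi * |r|)| := by
    rcases abs_choice r with h | h <;> rw [h]
    rw [mul_neg, Real.sin_neg, abs_neg]
  have h3 := Real.mul_le_sin (x := Real.pi * |r|) (by positivity)
    (by nlinarith [Real.pi_pos])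
  have h4 : 2 / Real.pi * (Real.pi * |r|) = 2 * |r| := by
    field_simp
  rw [h1, h2]
  have := le_abs_self (Real.sin (Real.pi * |r|))
  linarith

/-- A majorant, up to a factor `2`, of `min L (1 / distInt x)`. -/
def spike (L : ℕ) (x : ℝ) : ℝ := 2 * L / (1 + L * distInt x)

lemma spike_nonneg (L : ℕ) (x : ℝ) : 0 ≤ spike L x := by
  have := distInt_nonneg x
  unfold spike; positivity

lemma spike_le (L : ℕ) (x : ℝ) : spike L x ≤ 2 * L := by
  have := distInt_nonneg x
  unfold spike
  apply div_le_self (by positivity)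
  have : 0 ≤ L * distInt x := by positivity
  linarith

lemma continuous_spike (L : ℕ) : Continuous (spike L) := by
  unfold spike
  refine continuous_const.div (by have := continuous_distInt; fun_prop) fun x => ?_
  have := distInt_nonneg x
  positivity

lemma spike_neg (L : ℕ) (x : ℝ) : spike L (-x) = spike L x := by
  simp [spike, distInt_neg]

/-- A geometric sum `S` satisfies both `‖S‖ ≤ L` and `‖S‖ * distInt β ≤ 1`; adding the first to `L`
times the second produces the factor `2` in `spike`. -/
lemma norm_sum_unitExp_le {M L : ℕ} (hML : M ≤ L) (β c : ℝ) :
    ‖∑ j ∈ Finset.range M, unitExp (j * β + c)‖ ≤ spike L β := by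
  set S := ∑ j ∈ Finset.range M, unitExp (j * β + c) with hS
  have h0 := distInt_nonneg β
  have h1 : ‖S‖ ≤ L := by
    refine (norm_sum_le _ _).trans ?_
    simp only [norm_unitExp, Finset.sum_const, Finset.card_range, nsmul_eq_mul, mul_one]
    exact_mod_cast hML
  have h2 : ‖S‖ * ‖unitExp β - 1‖ ≤ 2 := by
    have : S * (unitExp β - 1) = unitExp c * (unitExp β ^ M - 1) := by
      have : S = (∑ j ∈ Finset.range M, unitExp β ^ j) * unitExp c := by
        rw [hS, Finset.sum_mul]
        refine Finset.sum_congr rfl fun j _ => ?_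
        rw [unitExp_add, unitExp_nat_mul]
      rw [this, mul_right_comm, geom_sum_mul, mul_comm]
    rw [← norm_mul, this, norm_mul, norm_unitExp, one_mul]
    refine (norm_sub_le _ _).trans ?_
    rw [norm_pow, norm_unitExp]
    norm_num
  have h3 : ‖S‖ * distInt β ≤ 1 := by
    have := mul_le_mul_of_nonneg_left (four_mul_distInt_le β) (norm_nonneg S)
    linarith
  unfold spike
  rw [le_div_iff₀ (by positivity)]
  have : (L : ℝ) * (‖S‖ * distInt β) ≤ L * 1 := by gcongr
  linarith

/-- Pairs `j < i` are grouped by their difference `k = i - j`, which is the rearrangement behind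
Weyl differencing. -/
lemma sum_Ico_sum_range_eq {E : Type*} [AddCommMonoid E] (F : ℕ → ℕ → E) (L : ℕ) :
    ∑ k ∈ Finset.Ico 1 L, ∑ j ∈ Finset.range (L - k), F (j + k) j
      = ∑ i ∈ Finset.range L, ∑ j ∈ Finset.range i, F i j := by
  rw [Finset.sum_sigma', Finset.sum_sigma']
  refine Finset.sum_nbij' (fun p => ⟨p.2 + p.1, p.2⟩) (fun p => ⟨p.1 - p.2, p.2⟩) ?_ ?_ ?_ ?_ ?_
  all_goals
    rintro ⟨a, b⟩ h
    simp only [Finset.mem_sigma, Finset.mem_Ico, Finset.mem_range] at h ⊢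
  · omega
  · omega
  · simp
  · rw [Nat.add_sub_cancel' (by omega)]

lemma norm_sq_sum_range (f : ℕ → ℂ) (L : ℕ) :
    ‖∑ j ∈ Finset.range L, f j‖ ^ 2 = ∑ j ∈ Finset.range L, ‖f j‖ ^ 2 +
      2 * (∑ i ∈ Finset.range L, ∑ j ∈ Finset.range i, f i * (starRingEnd ℂ) (f j)).re := by
  induction L with
  | zero => simp
  | succ n ih =>
    rw [Finset.sum_range_succ, Finset.sum_range_succ (fun j => ‖f j‖ ^ 2),
      Finset.sum_range_succ (fun i => ∑ j ∈ Finset.range i, f i * (starRingEnd ℂ) (f j)),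
      ← Finset.mul_sum, ← map_sum]
    simp only [Complex.sq_norm] at ih ⊢
    rw [Complex.normSq_add, ih, Complex.add_re]
    have : ((∑ j ∈ Finset.range n, f j) * (starRingEnd ℂ) (f n)).re
        = (f n * (starRingEnd ℂ) (∑ j ∈ Finset.range n, f j)).re := by
      simp [Complex.mul_re]; ring
    rw [this]; ring

/-- Weyl's differencing inequality for a quadratic exponential sum. -/
lemma norm_sq_sum_quadratic_le (L : ℕ) (θ γ : ℝ) :
    ‖∑ j ∈ Finset.range L, unitExp (θ * (j + γ) ^ 2)‖ ^ 2 ≤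
      L + 2 * ∑ k ∈ Finset.Ico 1 L, spike L (2 * θ * k) := by
  rw [norm_sq_sum_range]
  simp only [norm_unitExp, one_pow, Finset.sum_const, Finset.card_range, nsmul_eq_mul, mul_one]
  gcongr
  rw [← sum_Ico_sum_range_eq (fun i j => unitExp (θ * (i + γ) ^ 2) *
    (starRingEnd ℂ) (unitExp (θ * (j + γ) ^ 2)))]
  refine (Complex.re_le_norm _).trans ((norm_sum_le _ _).trans (Finset.sum_le_sum fun k _ => ?_))
  refine le_trans (le_of_eq ?_) (norm_sum_unitExp_le (Nat.sub_le L k) (2 * θ * k)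
    (θ * (k ^ 2 + 2 * k * γ)))
  congr 1
  refine Finset.sum_congr rfl fun j _ => ?_
  rw [conj_unitExp, ← unitExp_add]
  congr 1
  push_cast
  ring

/-! ### The divisor bound and sums of spikes along progressions -/

/-- Compare the factors `a + 1` and `p ^ (a * ε)` prime by prime. If `p ≥ 2 ^ (1 / ε)` then `p ^ ε ≥
2` and `a + 1 ≤ 2 ^ a` suffices. Each of the at most `P` smaller primes loses a factor `K`, by
Bernoulli's inequality. -/
lemma card_divisors_le_rpow (ε : ℝ) (hε : 0 < ε) :
    ∃ C : ℝ, 0 ≤ C ∧ ∀ n : ℕ, n ≠ 0 → (n.divisors.card : ℝ) ≤ C * (n : ℝ) ^ ε := by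
  obtain ⟨P, hP⟩ := exists_nat_ge ((2 : ℝ) ^ (1 / ε))
  set K : ℝ := max 1 (1 / (ε * Real.log 2)) with hK
  have hlog : 0 < Real.log 2 := Real.log_pos (by norm_num)
  have hK1 : 1 ≤ K := le_max_left _ _
  have hK2 : 1 ≤ K * (ε * Real.log 2) := by
    have := le_max_right 1 (1 / (ε * Real.log 2))
    rwa [← hK, div_le_iff₀ (by positivity)] at this
  have term : ∀ p a : ℕ, p.Prime →
      ((a : ℝ) + 1) ≤ (if p < P then K else 1) * ((p : ℝ) ^ a) ^ ε := by
    intro p a hp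
    have hp2 : (2 : ℝ) ≤ p := by exact_mod_cast hp.two_le
    rw [← Real.rpow_natCast, ← Real.rpow_mul (by positivity), mul_comm (a : ℝ) ε,
      Real.rpow_mul (by positivity), Real.rpow_natCast]
    split_ifs with h
    · have h1 : (1 : ℝ) + a * (ε * Real.log 2) ≤ ((p : ℝ) ^ ε) ^ a := by
        calc (1 : ℝ) + a * (ε * Real.log 2) ≤ (1 + ε * Real.log 2) ^ a := by
              apply one_add_mul_le_pow
              have : 0 ≤ ε * Real.log 2 := by positivity
              linarith
          _ ≤ ((p : ℝ) ^ ε) ^ a := by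
              gcongr
              calc 1 + ε * Real.log 2 ≤ Real.exp (ε * Real.log 2) := by
                    have := Real.add_one_le_exp (ε * Real.log 2); linarith
                _ = (2 : ℝ) ^ ε := by rw [Real.rpow_def_of_pos (by norm_num)]; ring_nf
                _ ≤ _ := by gcongr
      have ha : (0 : ℝ) ≤ a := by positivity
      nlinarith
    · have h2 : (2 : ℝ) ≤ (p : ℝ) ^ ε := by
        have : (2 : ℝ) ^ (1 / ε) ≤ p := hP.trans (by exact_mod_cast not_lt.mp h)
        calc (2 : ℝ) = ((2 : ℝ) ^ (1 / ε)) ^ ε := by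
              rw [← Real.rpow_mul (by norm_num), one_div, inv_mul_cancel₀ hε.ne', Real.rpow_one]
          _ ≤ _ := by gcongr
      rw [one_mul]
      calc (a : ℝ) + 1 ≤ 2 ^ a := by exact_mod_cast Nat.lt_two_pow_self
        _ ≤ _ := by gcongr
  refine ⟨K ^ P, by positivity, fun n hn => ?_⟩
  rw [Nat.card_divisors hn]
  push_cast
  calc ∏ p ∈ n.primeFactors, ((n.factorization p : ℝ) + 1)
      ≤ ∏ p ∈ n.primeFactors, ((if p < P then K else 1) * ((p : ℝ) ^ n.factorization p) ^ ε) :=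
        Finset.prod_le_prod (fun p _ => by positivity)
          fun p hp => term p _ (Nat.prime_of_mem_primeFactors hp)
    _ = (∏ p ∈ n.primeFactors, (if p < P then K else 1)) * (n : ℝ) ^ ε := by
        rw [Finset.prod_mul_distrib, Real.finsetProd_rpow _ _ fun p _ => by positivity]
        congr 2
        conv_rhs => rw [← Nat.prod_factorization_pow_eq_self hn]
        rw [Nat.prod_factorization_eq_prod_primeFactors]
        push_cast
        rfl
    _ ≤ K ^ P * (n : ℝ) ^ ε := by
        gcongr
        rw [Finset.prod_ite, Finset.prod_const, Finset.prod_const_one, mul_one]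
        apply pow_le_pow_right₀ hK1
        calc _ ≤ (Finset.range P).card :=
              Finset.card_le_card fun p hp => by simp at hp ⊢; exact hp.2
          _ = P := Finset.card_range P

lemma card_le_of_sub_le (S : Finset ℤ) (D : ℝ) (hD : 0 ≤ D)
    (h : ∀ a ∈ S, ∀ b ∈ S, ((a : ℝ) - b) ≤ D) : (S.card : ℝ) ≤ D + 1 := by
  rcases S.eq_empty_or_nonempty with rfl | hS
  · simp; linarith
  set a := S.min' hS with ha
  have hsub : S ⊆ Finset.Icc a (a + ⌊D⌋) := by
    intro b hb
    rw [Finset.mem_Icc]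
    refine ⟨S.min'_le b hb, ?_⟩
    have h1 := h b hb a (S.min'_mem hS)
    have : b - a ≤ ⌊D⌋ := by rw [Int.le_floor]; push_cast; exact h1
    linarith
  have h2 := Finset.card_le_card hsub
  rw [Int.card_Icc] at h2
  have h0 : 0 ≤ ⌊D⌋ := Int.floor_nonneg.mpr hD
  have h3 : (S.card : ℤ) ≤ ⌊D⌋ + 1 := by omega
  have h4 : (S.card : ℝ) ≤ ⌊D⌋ + 1 := by exact_mod_cast h3
  linarith [Int.floor_le D]

/-- In a real arithmetic progression few terms are close to an integer. -/
lemma card_distInt_le (J : ℕ) {δ : ℝ} (hδ : 0 < δ) (v : ℝ) {η : ℝ} (hη : 0 ≤ η) :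
    (((Finset.range J).filter fun j : ℕ => distInt (v + δ * j) ≤ η).card : ℝ) ≤
      (2 * η / δ + 1) * (δ * J + 2) := by
  classical
  set F := (Finset.range J).filter fun j : ℕ => distInt (v + δ * j) ≤ η with hF
  set g : ℕ → ℤ := fun j => round (v + δ * j) with hg
  -- The nearest integers lie in an interval of length `δ * J + 1`; for each of them the admissible
  -- `j` lie in an interval of length `2 * η / δ`.
  have himage : ((F.image g).card : ℝ) ≤ δ * J + 1 + 1 := by
    apply card_le_of_sub_le _ _ (by positivity)
    intro a ha b hb
    rw [Finset.mem_image] at ha hb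
    obtain ⟨i, hi, rfl⟩ := ha
    obtain ⟨j, hj, rfl⟩ := hb
    simp only [hF, Finset.mem_filter, Finset.mem_range] at hi hj
    have h1 := abs_le.mp (abs_sub_round (v + δ * i))
    have h2 := abs_le.mp (abs_sub_round (v + δ * j))
    have hi' : (i : ℝ) ≤ J := by exact_mod_cast hi.1.le
    have h3 : δ * i ≤ δ * J := by gcongr
    have h4 : 0 ≤ δ * j := by positivity
    simp only [hg]
    linarith
  have hfib : ∀ m ∈ F.image g, ((F.filter fun j => g j = m).card : ℝ) ≤ 2 * η / δ + 1 := by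
    intro m _
    rw [← Finset.card_image_of_injective _ (Nat.cast_injective (R := ℤ))]
    apply card_le_of_sub_le _ _ (by positivity)
    intro a ha b hb
    rw [Finset.mem_image] at ha hb
    obtain ⟨i, hi, rfl⟩ := ha
    obtain ⟨j, hj, rfl⟩ := hb
    simp only [hF, Finset.mem_filter, Finset.mem_range, hg, distInt_eq] at hi hj
    have h1 := abs_le.mp hi.1.2
    have h2 := abs_le.mp hj.1.2
    rw [hi.2] at h1
    rw [hj.2] at h2
    rw [le_div_iff₀ hδ]
    push_cast
    nlinarith
  have hcard := Finset.card_eq_sum_card_image g F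
  have : (F.card : ℝ) = ∑ m ∈ F.image g, ((F.filter fun j => g j = m).card : ℝ) := by
    exact_mod_cast hcard
  rw [this]
  calc _ ≤ ∑ m ∈ F.image g, (2 * η / δ + 1) := Finset.sum_le_sum hfib
    _ = (2 * η / δ + 1) * (F.image g).card := by rw [Finset.sum_const, nsmul_eq_mul, mul_comm]
    _ ≤ _ := by
      have : 0 ≤ 2 * η / δ + 1 := by positivity
      gcongr
      linarith

/-- Dyadic decomposition: for the largest `i ≤ I` with `distInt x ≤ 2 ^ (-i)`, the single term of
index `i` already dominates the spike. -/
lemma spike_le_sum (L I : ℕ) (hL : L ≤ 2 ^ I) (x : ℝ) :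
    spike L x ≤ ∑ i ∈ Finset.range (I + 1),
      if distInt x ≤ (1 / 2 : ℝ) ^ i then (2 : ℝ) ^ (i + 1) * 2 else 0 := by
  set d := distInt x with hd
  have hd0 : 0 ≤ d := distInt_nonneg x
  have hd1 : d ≤ 1 := (distInt_le_half x).trans (by norm_num)
  have hLr : (L : ℝ) ≤ 2 ^ I := by exact_mod_cast hL
  classical
  set i := Nat.findGreatest (fun i => d ≤ (1 / 2 : ℝ) ^ i) I with hi
  have hiI : i ≤ I := Nat.findGreatest_le I
  have hspec : d ≤ (1 / 2 : ℝ) ^ i :=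
    Nat.findGreatest_spec (P := fun i => d ≤ (1 / 2 : ℝ) ^ i) (Nat.zero_le I) (by simpa using hd1)
  have hbound : spike L x ≤ (2 : ℝ) ^ (i + 1) * 2 := by
    rcases hiI.lt_or_eq with h | h
    · have h1 : (1 / 2 : ℝ) ^ (i + 1) < d := by
        have := Nat.findGreatest_is_greatest (P := fun i => d ≤ (1 / 2 : ℝ) ^ i)
          (show Nat.findGreatest _ I < i + 1 from Nat.lt_succ_self i) h
        exact not_le.mp this
      have h2 : 1 ≤ (2 : ℝ) ^ (i + 1) * d := by
        have : (2 : ℝ) ^ (i + 1) * (1 / 2 : ℝ) ^ (i + 1) = 1 := by rw [← mul_pow]; norm_num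
        nlinarith [pow_pos (show (0 : ℝ) < 2 by norm_num) (i + 1)]
      unfold spike
      rw [← hd, div_le_iff₀ (by positivity)]
      have h3 : (0 : ℝ) ≤ L := by positivity
      have h4 : (0 : ℝ) < 2 ^ (i + 1) := by positivity
      nlinarith
    · refine (spike_le L x).trans ?_
      rw [h, pow_succ]
      nlinarith [pow_pos (show (0 : ℝ) < 2 by norm_num) I]
  refine hbound.trans ?_
  have := Finset.single_le_sum (f := fun i => if d ≤ (1 / 2 : ℝ) ^ i then (2 : ℝ) ^ (i + 1) * 2 else 0)
    (s := Finset.range (I + 1)) (fun j _ => by split_ifs <;> positivity)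
    (Finset.mem_range.mpr (Nat.lt_succ_of_le hiI))
  rwa [if_pos hspec] at this

/-- The progression has bounded total length `2 * A * L / R`, so `O(1 + 2 ^ (-i) * R)` of its terms
lie within `2 ^ (-i)` of an integer. The dyadic level `i` contributes `O(R + 2 ^ i)`, and there are
`O(R ^ ε)` levels. -/
lemma sum_spike_le (A C₁ ε : ℝ) (hA : 0 < A) (hC₁ : 0 < C₁) (hε : 0 < ε) :
    ∃ C : ℝ, 0 ≤ C ∧ ∀ (R : ℝ) (L : ℕ) (v : ℝ), 1 < R → 1 ≤ L → L ≤ C₁ * R →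
      ∑ j ∈ Finset.range L, spike L (v + 2 * A / R * j) ≤ C * R ^ (1 + ε) := by
  have hlog : 0 < Real.log 2 := Real.log_pos (by norm_num)
  set K := 2 * A * C₁ + 2 with hK
  have hK0 : 0 < K := by positivity
  set D := 1 + (2 * C₁) ^ ε / ε / Real.log 2 with hD
  have hD0 : 0 ≤ D := by positivity
  refine ⟨K * (4 / A * D + 16 * C₁), by positivity, fun R L v hR hL1 hL => ?_⟩
  have hR0 : 0 < R := by linarith
  set I := Nat.clog 2 L with hI
  have hLI : L ≤ 2 ^ I := Nat.le_pow_clog (by norm_num) L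
  have hIL : (2 : ℝ) ^ I ≤ 2 * L := by
    rcases Nat.lt_or_ge 1 L with h | h
    · have h1 := Nat.pow_pred_clog_lt_self (b := 2) (by norm_num) h
      have h2 : 0 < I := Nat.clog_pos (by norm_num) h
      have h3 : 2 ^ I = 2 * 2 ^ (I - 1) := by rw [← pow_succ', Nat.sub_add_cancel h2]
      have h4 : 2 ^ I ≤ 2 * L := by rw [h3]; exact Nat.mul_le_mul_left 2 h1.le
      exact_mod_cast h4
    · have : L = 1 := by omega
      have h2 : I = 0 := by rw [hI, this]; simp
      rw [h2, this]; norm_num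
  have hIlog : (I + 1 : ℝ) ≤ D * R ^ ε := by
    have h1 : I * Real.log 2 ≤ Real.log (2 * C₁ * R) := by
      rw [← Real.log_pow]
      apply Real.log_le_log (by positivity)
      linarith
    have h2 := Real.log_le_rpow_div (x := 2 * C₁ * R) (by positivity) hε
    rw [Real.mul_rpow (by positivity) hR0.le] at h2
    have h3 : (I : ℝ) ≤ (2 * C₁) ^ ε / ε / Real.log 2 * R ^ ε := by
      have : (2 * C₁) ^ ε / ε / Real.log 2 * R ^ ε = ((2 * C₁) ^ ε * R ^ ε / ε) / Real.log 2 := by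
        ring
      rw [this, le_div_iff₀ hlog]
      linarith
    have h4 : 1 ≤ R ^ ε := Real.one_le_rpow hR.le hε.le
    rw [hD]; linarith
  calc ∑ j ∈ Finset.range L, spike L (v + 2 * A / R * j)
      ≤ ∑ j ∈ Finset.range L, ∑ i ∈ Finset.range (I + 1),
        (if distInt (v + 2 * A / R * j) ≤ (1 / 2 : ℝ) ^ i then (2 : ℝ) ^ (i + 1) * 2 else 0) :=
        Finset.sum_le_sum fun j _ => spike_le_sum L I hLI _
    _ = ∑ i ∈ Finset.range (I + 1), (((Finset.range L).filter fun j : ℕ =>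
          distInt (v + 2 * A / R * j) ≤ (1 / 2 : ℝ) ^ i).card : ℝ) * ((2 : ℝ) ^ (i + 1) * 2) := by
        rw [Finset.sum_comm]
        refine Finset.sum_congr rfl fun i _ => ?_
        rw [← Finset.sum_filter, Finset.sum_const, nsmul_eq_mul]
    _ ≤ ∑ i ∈ Finset.range (I + 1), (4 * K * R / A + 4 * K * 2 ^ i) := by
        refine Finset.sum_le_sum fun i _ => ?_
        have h1 := card_distInt_le L (show 0 < 2 * A / R by positivity) v
          (show (0 : ℝ) ≤ (1 / 2 : ℝ) ^ i by positivity)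
        have h2 : 2 * A / R * L + 2 ≤ K := by
          have : 2 * A / R * L ≤ 2 * A / R * (C₁ * R) := by gcongr
          have h3 : 2 * A / R * (C₁ * R) = 2 * A * C₁ := by field_simp
          rw [hK]; linarith
        have h3 : (1 / 2 : ℝ) ^ i * 2 ^ i = 1 := by rw [← mul_pow]; norm_num
        calc _ ≤ ((2 * (1 / 2 : ℝ) ^ i / (2 * A / R) + 1) * K) * ((2 : ℝ) ^ (i + 1) * 2) := by
              gcongr
              refine h1.trans ?_
              gcongr
          _ = 4 * K * R / A * ((1 / 2 : ℝ) ^ i * 2 ^ i) + 4 * K * 2 ^ i := by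
              field_simp; ring
          _ = _ := by rw [h3, mul_one]
    _ = K * (4 / A * ((I + 1) * R) + 4 * (2 * 2 ^ I - 1)) := by
        rw [Finset.sum_add_distrib, ← Finset.mul_sum, geom_sum_eq (by norm_num)]
        simp only [Finset.sum_const, Finset.card_range, nsmul_eq_mul]
        push_cast
        rw [pow_succ]
        ring
    _ ≤ K * (4 / A * (D * R ^ ε * R) + 16 * (C₁ * R)) := by
        have : 4 * (2 * (2 : ℝ) ^ I - 1) ≤ 16 * (C₁ * R) := by linarith
        gcongr
    _ ≤ K * (4 / A * (D * R ^ (1 + ε)) + 16 * (C₁ * R ^ (1 + ε))) := by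
        have h1 : R ^ (1 + ε) = R ^ ε * R := by
          rw [add_comm, Real.rpow_add hR0, Real.rpow_one]
        have h2 : R ≤ R ^ (1 + ε) := by
          conv_lhs => rw [← Real.rpow_one R]
          exact Real.rpow_le_rpow_of_exponent_le hR.le (by linarith)
        rw [mul_assoc D, ← h1]
        gcongr
    _ = _ := by ring

lemma sum_range_mul_eq {E : Type*} [AddCommMonoid E] (f : ℕ → E) (H L : ℕ) :
    ∑ n ∈ Finset.range (H * L), f n
      = ∑ b ∈ Finset.range H, ∑ j ∈ Finset.range L, f (b * L + j) := by
  induction H with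
  | zero => simp
  | succ H ih => rw [Nat.succ_mul, Finset.sum_range_add, ih, Finset.sum_range_succ]

/-- Given `n = h * k` with `h ≥ 1`, the divisor `h` determines `k`. -/
lemma sum_sum_mul_le (f : ℕ → ℝ) (hf : ∀ n, 0 ≤ f n) (H L : ℕ) :
    ∑ h ∈ Finset.Ico 1 H, ∑ k ∈ Finset.Ico 1 L, f (h * k)
      ≤ ∑ n ∈ Finset.range (H * L), (n.divisors.card : ℝ) * f n := by
  rw [← Finset.sum_product',
    ← Finset.sum_fiberwise_of_maps_to (t := Finset.range (H * L)) (g := fun p : ℕ × ℕ => p.1 * p.2)]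
  · refine Finset.sum_le_sum fun n hn => ?_
    rw [Finset.sum_congr rfl (g := fun _ => f n), Finset.sum_const, nsmul_eq_mul]
    · gcongr
      · exact hf n
      · refine Finset.card_le_card_of_injOn (fun p => p.1) ?_ ?_
        · intro p hp
          simp at hp ⊢
          obtain ⟨⟨⟨h1, h2⟩, h3, h4⟩, rfl⟩ := hp
          exact ⟨Dvd.intro _ rfl, Nat.mul_ne_zero (by omega) (by omega)⟩
        · intro p hp q hq hpq
          simp at hp hq hpq
          obtain ⟨⟨⟨h1, h2⟩, h3, h4⟩, h5⟩ := hp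
          obtain ⟨_, h6⟩ := hq
          rw [← h5, ← hpq] at h6
          exact Prod.ext hpq (Nat.eq_of_mul_eq_mul_left h1 h6).symm
    · intro p hp
      simp at hp
      rw [hp.2]
  · intro p hp
    simp at hp ⊢
    exact Nat.mul_lt_mul'' hp.1.2 hp.2.2

/-- The divisor-type bound for the double sum over frequencies and differences. -/
lemma sum_sum_spike_le (A C₁ ε : ℝ) (hA : 0 < A) (hC₁ : 0 < C₁) (hε : 0 < ε) :
    ∃ C : ℝ, 0 ≤ C ∧ ∀ (R : ℝ) (L H : ℕ) (v : ℝ), 1 < R → L ≤ C₁ * R →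
      ∑ h ∈ Finset.Ico 1 H, ∑ k ∈ Finset.Ico 1 L,
        (h : ℝ) ^ (-1 - ε) * spike L (v + 2 * A / R * (h * k : ℕ)) ≤ C * R ^ (1 + 2 * ε) := by
  obtain ⟨C₂, hC₂, hblock⟩ := sum_spike_le A C₁ ε hA hC₁ hε
  obtain ⟨C₃, hC₃, hdiv⟩ := card_divisors_le_rpow (ε / 2) (by positivity)
  have hsum : Summable fun b : ℕ => ((b + 1 : ℕ) : ℝ) ^ (-1 - ε / 2) :=
    (summable_nat_add_iff 1).mpr (Real.summable_nat_rpow.mpr (by linarith))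
  set Z := ∑' b : ℕ, ((b + 1 : ℕ) : ℝ) ^ (-1 - ε / 2) with hZ
  have hZ0 : 0 ≤ Z := tsum_nonneg fun b => by positivity
  refine ⟨C₃ * 2 ^ (1 + ε) * C₁ ^ (ε / 2) * C₂ * Z, by positivity, fun R L H v hR hL => ?_⟩
  have hR0 : 0 < R := by linarith
  rcases Nat.eq_zero_or_pos L with rfl | hL1
  · simp; positivity
  have hL1' : (1 : ℝ) ≤ L := by exact_mod_cast hL1
  -- The weight `h ^ (-1 - ε)` is majorised by a function of `n = h * k` alone: since `k < L` and `h
  -- ≥ 1`, the block number `n / L + 1` is at most `2 * h`.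
  set f : ℕ → ℝ := fun n => 2 ^ (1 + ε) * ((n / L + 1 : ℕ) : ℝ) ^ (-1 - ε) *
    spike L (v + 2 * A / R * n) with hf
  have hf0 : ∀ n, 0 ≤ f n := fun n => by
    have := spike_nonneg L (v + 2 * A / R * n)
    positivity
  calc ∑ h ∈ Finset.Ico 1 H, ∑ k ∈ Finset.Ico 1 L,
        (h : ℝ) ^ (-1 - ε) * spike L (v + 2 * A / R * (h * k : ℕ))
      ≤ ∑ h ∈ Finset.Ico 1 H, ∑ k ∈ Finset.Ico 1 L, f (h * k) := by
        refine Finset.sum_le_sum fun h hh => Finset.sum_le_sum fun k hk => ?_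
        rw [Finset.mem_Ico] at hh hk
        have h0 : (0 : ℝ) < h := by exact_mod_cast hh.1
        refine mul_le_mul_of_nonneg_right ?_ (spike_nonneg _ _)
        have h1 : h * k / L + 1 ≤ 2 * h := by
          have : h * k / L ≤ h := by
            apply Nat.div_le_of_le_mul
            rw [mul_comm]
            exact Nat.mul_le_mul_right h hk.2.le
          omega
        have h2 : ((h * k / L + 1 : ℕ) : ℝ) ≤ 2 * h := by exact_mod_cast h1
        calc (h : ℝ) ^ (-1 - ε) = 2 ^ (1 + ε) * (2 * h : ℝ) ^ (-1 - ε) := by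
              rw [Real.mul_rpow (by norm_num) h0.le, ← mul_assoc, ← Real.rpow_add (by norm_num)]
              norm_num
          _ ≤ _ := by
              exact mul_le_mul_of_nonneg_left
                (Real.rpow_le_rpow_of_nonpos (by positivity) h2 (by linarith)) (by positivity)
    _ ≤ ∑ n ∈ Finset.range (H * L), (n.divisors.card : ℝ) * f n := sum_sum_mul_le f hf0 H L
    _ ≤ ∑ n ∈ Finset.range (H * L), C₃ * 2 ^ (1 + ε) * (L : ℝ) ^ (ε / 2) *
          (((n / L + 1 : ℕ) : ℝ) ^ (-1 - ε / 2) * spike L (v + 2 * A / R * n)) := by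
        refine Finset.sum_le_sum fun n _ => ?_
        have hs := spike_nonneg L (v + 2 * A / R * n)
        set b : ℝ := ((n / L + 1 : ℕ) : ℝ) with hb
        have hb0 : 0 < b := by positivity
        -- As `n ≤ b * L`, the divisor bound uses up `b ^ (ε / 2)`; the remaining weight `b ^ (-1 -
        -- ε / 2)` is still summable over the blocks.
        have h1 : (n.divisors.card : ℝ) ≤ C₃ * (b ^ (ε / 2) * (L : ℝ) ^ (ε / 2)) := by
          rcases Nat.eq_zero_or_pos n with rfl | hn
          · simp only [Nat.divisors_zero, Finset.card_empty, Nat.cast_zero]; positivity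
          · refine (hdiv n hn.ne').trans ?_
            rw [← Real.mul_rpow (by positivity) (by positivity)]
            gcongr
            rw [hb]
            have : n ≤ (n / L + 1) * L := by
              rw [mul_comm]; exact (Nat.lt_mul_div_succ n hL1).le
            exact_mod_cast this
        calc (n.divisors.card : ℝ) * f n ≤ C₃ * (b ^ (ε / 2) * (L : ℝ) ^ (ε / 2)) *
              (2 ^ (1 + ε) * b ^ (-1 - ε) * spike L (v + 2 * A / R * n)) :=
              mul_le_mul_of_nonneg_right h1 (hf0 n)
          _ = C₃ * 2 ^ (1 + ε) * (L : ℝ) ^ (ε / 2) *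
              ((b ^ (ε / 2) * b ^ (-1 - ε)) * spike L (v + 2 * A / R * n)) := by ring
          _ = _ := by rw [← Real.rpow_add hb0]; ring_nf
    _ = C₃ * 2 ^ (1 + ε) * (L : ℝ) ^ (ε / 2) * ∑ b ∈ Finset.range H,
          ((b + 1 : ℕ) : ℝ) ^ (-1 - ε / 2) *
            ∑ j ∈ Finset.range L, spike L ((v + 2 * A / R * (b * L)) + 2 * A / R * j) := by
        rw [← Finset.mul_sum, sum_range_mul_eq]
        congr 1
        refine Finset.sum_congr rfl fun b _ => ?_
        rw [Finset.mul_sum]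
        refine Finset.sum_congr rfl fun j hj => ?_
        have : (b * L + j) / L = b := by
          rw [mul_comm, Nat.mul_add_div hL1, Nat.div_eq_of_lt (Finset.mem_range.mp hj), add_zero]
        rw [this]
        congr 2
        push_cast
        ring
    _ ≤ C₃ * 2 ^ (1 + ε) * (C₁ * R) ^ (ε / 2) * ∑ b ∈ Finset.range H,
          ((b + 1 : ℕ) : ℝ) ^ (-1 - ε / 2) * (C₂ * R ^ (1 + ε)) := by
        have : ∀ b : ℕ, 0 ≤ ∑ j ∈ Finset.range L, spike L ((v + 2 * A / R * (b * L)) + 2 * A / R * j) :=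
          fun b => Finset.sum_nonneg fun j _ => spike_nonneg _ _
        gcongr with b _
        · exact Finset.sum_nonneg fun b _ => mul_nonneg (by positivity) (this b)
        · exact hblock R L _ hR hL1 hL
    _ ≤ C₃ * 2 ^ (1 + ε) * (C₁ * R) ^ (ε / 2) * (Z * (C₂ * R ^ (1 + ε))) := by
        rw [← Finset.sum_mul]
        gcongr
        exact hsum.sum_le_tsum _ fun b _ => by positivity
    _ = C₃ * 2 ^ (1 + ε) * C₁ ^ (ε / 2) * C₂ * Z * (R ^ (ε / 2) * R ^ (1 + ε)) := by
        rw [Real.mul_rpow hC₁.le hR0.le]; ring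
    _ ≤ _ := by
        rw [← Real.rpow_add hR0]
        exact mul_le_mul_of_nonneg_left
          (Real.rpow_le_rpow_of_exponent_le hR.le (by linarith)) (by positivity)

/-! ### The smoothed cutoff and its Fourier transform -/

/-- A smoothed version, on the scale `R`, of the indicator function of `[0, X]`. -/
def smoothCutoff (R X t : ℝ) : ℝ := ∫ v in ((t - X) / R)..(t / R), Real.exp (-Real.pi * v ^ 2)

/-- The Fourier transform of `smoothCutoff`. -/
def cutoffTransform (R X τ : ℝ) : ℂ :=
  (Real.exp (-(Real.pi * R ^ 2) * τ ^ 2) : ℂ) * ∫ u in (0 : ℝ)..X, unitExp (-τ * u)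

lemma integral_exp_mul_unitExp {R : ℝ} (hR : 0 < R) (s : ℝ) :
    ∫ τ : ℝ, (Real.exp (-(Real.pi * R ^ 2) * τ ^ 2) : ℂ) * unitExp (τ * s)
      = ((1 / R * Real.exp (-Real.pi * (s / R) ^ 2) : ℝ) : ℂ) := by
  have hπ := Real.pi_pos
  have h := fourierIntegral_gaussian (b := ((Real.pi * R ^ 2 : ℝ) : ℂ))
    (by rw [Complex.ofReal_re]; positivity) ((2 * Real.pi * s : ℝ) : ℂ)
  have h2 : ((Real.pi : ℂ) / ((Real.pi * R ^ 2 : ℝ) : ℂ)) ^ (1 / 2 : ℂ) = ((1 / R : ℝ) : ℂ) := by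
    rw [← Complex.ofReal_div]
    have : (1 / 2 : ℂ) = ((1 / 2 : ℝ) : ℂ) := by push_cast; rfl
    rw [this, ← Complex.ofReal_cpow (by positivity), ← Real.sqrt_eq_rpow]
    congr 1
    have : Real.pi / (Real.pi * R ^ 2) = (1 / R) ^ 2 := by field_simp
    rw [this, Real.sqrt_sq (by positivity)]
  rw [h2] at h
  rw [Complex.ofReal_mul, Complex.ofReal_exp]
  convert h using 1
  · congr 1
    ext τ
    rw [unitExp, mul_comm]
    push_cast
    ring_nf
  · congr 2
    push_cast
    have h3 : (R : ℂ) ≠ 0 := by exact_mod_cast hR.ne'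
    have h4 : (Real.pi : ℂ) ≠ 0 := by exact_mod_cast hπ.ne'
    field_simp
    norm_num

lemma continuous_cutoffIntegral (X : ℝ) :
    Continuous fun τ : ℝ => ∫ u in (0 : ℝ)..X, unitExp (-τ * u) :=
  intervalIntegral.continuous_parametric_intervalIntegral_of_continuous'
    (by have := continuous_unitExp; fun_prop) 0 X

lemma continuous_cutoffTransform (R X : ℝ) : Continuous (cutoffTransform R X) := by
  have := continuous_cutoffIntegral X
  unfold cutoffTransform
  fun_prop

/-- The cutoff is the convolution of the indicator of `[0, X]` with the Gaussian `R⁻¹ * exp (-π * (v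
/ R) ^ 2)`, so Fourier inversion for the Gaussian and Fubini suffice. -/
lemma smoothCutoff_eq {R : ℝ} (hR : 0 < R) (X t : ℝ) :
    (smoothCutoff R X t : ℂ) = ∫ τ : ℝ, cutoffTransform R X τ * unitExp (τ * t) := by
  have hπ := Real.pi_pos
  have hint : Integrable (fun τ : ℝ => (Real.exp (-(Real.pi * R ^ 2) * τ ^ 2) : ℂ)) :=
    (integrable_exp_neg_mul_sq (by positivity)).ofReal
  have h1 : ∀ τ : ℝ, cutoffTransform R X τ * unitExp (τ * t)
      = ∫ u in (0 : ℝ)..X, (Real.exp (-(Real.pi * R ^ 2) * τ ^ 2) : ℂ) * unitExp (τ * (t - u)) := by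
    intro τ
    rw [cutoffTransform, mul_assoc, ← intervalIntegral.integral_mul_const,
      ← intervalIntegral.integral_const_mul]
    congr 1
    ext u
    rw [← unitExp_add]
    ring_nf
  simp_rw [h1]
  rw [← intervalIntegral_integral_swap]
  · simp_rw [integral_exp_mul_unitExp hR]
    rw [intervalIntegral.integral_ofReal, intervalIntegral.integral_const_mul]
    have := intervalIntegral.integral_comp_sub_div (a := 0) (b := X)
      (fun v => Real.exp (-Real.pi * v ^ 2)) hR.ne' (t / R)
    simp_rw [sub_div]
    rw [this, smoothCutoff, sub_div, zero_div, sub_zero, smul_eq_mul, ← mul_assoc,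
      one_div_mul_cancel hR.ne', one_mul]
  · have hc : Integrable (fun _ : ℝ => (1 : ℂ)) (volume.restrict (Set.uIoc 0 X)) := by
      have : IsFiniteMeasure (volume.restrict (Set.uIoc 0 X)) :=
        ⟨by rw [Measure.restrict_apply_univ, Set.uIoc]; exact measure_Ioc_lt_top⟩
      exact integrable_const 1
    refine (hc.mul_prod hint).mono ?_ ?_
    · apply Continuous.aestronglyMeasurable
      have := continuous_unitExp
      fun_prop
    · refine Filter.Eventually.of_forall fun p => ?_
      simp [Function.uncurry, norm_unitExp]

lemma integrable_exp_neg_pi_sq : Integrable fun v : ℝ => Real.exp (-Real.pi * v ^ 2) :=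
  integrable_exp_neg_mul_sq Real.pi_pos

/-- A factor `exp (-v ^ 2) ≤ 1 / (1 + w ^ 2)` is split off the Gaussian; what remains has total mass
`√(π / (π - 1)) ≤ 2`. -/
lemma setIntegral_exp_neg_pi_sq_le (s : Set ℝ) (hs : MeasurableSet s) (w : ℝ)
    (h : ∀ v ∈ s, w ^ 2 ≤ v ^ 2) :
    ∫ v in s, Real.exp (-Real.pi * v ^ 2) ≤ 2 / (1 + w ^ 2) := by
  have hπ := Real.pi_gt_three
  have hi : Integrable fun v : ℝ => Real.exp (-(Real.pi - 1) * v ^ 2) :=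
    integrable_exp_neg_mul_sq (by linarith)
  calc ∫ v in s, Real.exp (-Real.pi * v ^ 2)
      ≤ ∫ v in s, 1 / (1 + w ^ 2) * Real.exp (-(Real.pi - 1) * v ^ 2) := by
        refine setIntegral_mono_on integrable_exp_neg_pi_sq.integrableOn
          (hi.const_mul _).integrableOn hs fun v hv => ?_
        rw [one_div, inv_mul_eq_div, le_div_iff₀ (by positivity)]
        have h1 : 1 + w ^ 2 ≤ Real.exp (v ^ 2) := by
          have := Real.add_one_le_exp (v ^ 2)
          linarith [h v hv]
        calc Real.exp (-Real.pi * v ^ 2) * (1 + w ^ 2)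
            ≤ Real.exp (-Real.pi * v ^ 2) * Real.exp (v ^ 2) := by gcongr
          _ = _ := by rw [← Real.exp_add]; ring_nf
    _ ≤ ∫ v, 1 / (1 + w ^ 2) * Real.exp (-(Real.pi - 1) * v ^ 2) :=
        setIntegral_le_integral (hi.const_mul _)
          (Filter.Eventually.of_forall fun v => by positivity)
    _ = 1 / (1 + w ^ 2) * √(Real.pi / (Real.pi - 1)) := by
        rw [integral_const_mul, integral_gaussian]
    _ ≤ 1 / (1 + w ^ 2) * 2 := by
        gcongr
        rw [Real.sqrt_le_left (by norm_num), div_le_iff₀ (by linarith)]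
        linarith
    _ = _ := by ring

lemma integral_exp_neg_pi_sq : ∫ v : ℝ, Real.exp (-Real.pi * v ^ 2) = 1 := by
  rw [integral_gaussian, div_self Real.pi_ne_zero, Real.sqrt_one]

lemma smoothCutoff_le_one {R X t : ℝ} (hR : 0 < R) (hX : 0 ≤ X) : smoothCutoff R X t ≤ 1 := by
  have : (t - X) / R ≤ t / R := by gcongr; linarith
  rw [smoothCutoff, intervalIntegral.integral_of_le this, ← integral_exp_neg_pi_sq]
  exact setIntegral_le_integral integrable_exp_neg_pi_sq
    (Filter.Eventually.of_forall fun v => by positivity)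

lemma smoothCutoff_nonneg {R X t : ℝ} (hR : 0 < R) (hX : 0 ≤ X) : 0 ≤ smoothCutoff R X t := by
  have : (t - X) / R ≤ t / R := by gcongr; linarith
  exact intervalIntegral.integral_nonneg this fun v _ => by positivity

/-- The Gaussian has mass `1`. For `t ≤ X` the difference is the mass of the two tails outside `[(t
- X) / R, t / R]`; for `t > X` it is at most the tail beyond `(t - X) / R`. -/
lemma abs_indicator_sub_smoothCutoff_le {R X t : ℝ} (hR : 0 < R) (hX : 0 ≤ X) (ht : 0 ≤ t) :
    |(if t ≤ X then 1 else 0) - smoothCutoff R X t|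
      ≤ 2 / (1 + ((t - X) / R) ^ 2) + 2 / (1 + (t / R) ^ 2) := by
  have hle : (t - X) / R ≤ t / R := by gcongr; linarith
  have hi := integrable_exp_neg_pi_sq
  have htR : 0 ≤ t / R := by positivity
  split_ifs with h
  · have hneg : (t - X) / R ≤ 0 := div_nonpos_of_nonpos_of_nonneg (by linarith) hR.le
    rw [abs_of_nonneg (by linarith [smoothCutoff_le_one (t := t) hR hX])]
    have h1 : (1 : ℝ) = (∫ v in Set.Iic (t / R), Real.exp (-Real.pi * v ^ 2)) +
        ∫ v in Set.Ioi (t / R), Real.exp (-Real.pi * v ^ 2) := by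
      rw [← integral_exp_neg_pi_sq]
      exact (intervalIntegral.integral_Iic_add_Ioi hi.integrableOn hi.integrableOn).symm
    have h2 := intervalIntegral.integral_Iic_sub_Iic (a := (t - X) / R) (b := t / R)
      hi.integrableOn hi.integrableOn
    have h3 := setIntegral_exp_neg_pi_sq_le (Set.Iic ((t - X) / R)) measurableSet_Iic
      ((t - X) / R) fun v hv => by
        have : v ≤ (t - X) / R := hv
        nlinarith
    have h4 := setIntegral_exp_neg_pi_sq_le (Set.Ioi (t / R)) measurableSet_Ioi
      (t / R) fun v hv => by
        have : t / R < v := hv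
        nlinarith
    rw [smoothCutoff, ← h2]
    linarith
  · have hpos : 0 ≤ (t - X) / R := div_nonneg (by linarith) hR.le
    rw [zero_sub, abs_neg, abs_of_nonneg (smoothCutoff_nonneg hR hX), smoothCutoff,
      intervalIntegral.integral_of_le hle]
    have h3 := setIntegral_exp_neg_pi_sq_le (Set.Ioc ((t - X) / R) (t / R)) measurableSet_Ioc
      ((t - X) / R) fun v hv => by
        have := hv.1
        nlinarith
    have : 0 ≤ 2 / (1 + (t / R) ^ 2) := by positivity
    linarith

/-- The integral of the character over `[0, X]` is at most `X` and at most `|τ|⁻¹`. Interpolating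
with exponents `ε` and `1 - ε` gives a singularity integrable at `τ = 0`, at the price of `X ^ ε`.
-/
lemma norm_cutoffTransform_le {R X ε τ : ℝ} (hX : 0 ≤ X) (hε : 0 < ε) (hε1 : ε < 1)
    (hτ : τ ≠ 0) :
    ‖cutoffTransform R X τ‖ ≤
      X ^ ε * (|τ| ^ (ε - 1) * Real.exp (-(Real.pi * R ^ 2) * τ ^ 2)) := by
  have hτ' : 0 < |τ| := abs_pos.mpr hτ
  have hπ := Real.pi_gt_three
  set I := ∫ u in (0 : ℝ)..X, unitExp (-τ * u) with hI
  have h1 : ‖I‖ ≤ X := by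
    have := intervalIntegral.norm_integral_le_of_norm_le_const (a := 0) (b := X) (C := 1)
      (f := fun u => unitExp (-τ * u)) fun x _ => (norm_unitExp _).le
    rwa [sub_zero, one_mul, abs_of_nonneg hX] at this
  have h2 : ‖I‖ ≤ |τ|⁻¹ := by
    have hc : (2 * Real.pi * (-τ) * Complex.I : ℂ) ≠ 0 := by
      simp [Real.pi_ne_zero, hτ]
    have h3 : I = (unitExp (-τ * X) - unitExp (-τ * 0)) / (2 * Real.pi * (-τ) * Complex.I) := by
      have := integral_exp_mul_complex (a := 0) (b := X) hc
      rw [hI]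
      unfold unitExp
      convert this using 1
      · congr 1; ext u; push_cast; ring_nf
      · push_cast; ring_nf
    have h4 : ‖(2 * Real.pi * (-τ) * Complex.I : ℂ)‖ = 2 * Real.pi * |τ| := by
      simp [abs_of_pos Real.pi_pos]
    rw [h3, norm_div, h4, div_le_iff₀ (by positivity)]
    have h5 : |τ|⁻¹ * (2 * Real.pi * |τ|) = 2 * Real.pi := by field_simp
    rw [h5]
    refine (norm_sub_le _ _).trans ?_
    rw [norm_unitExp, norm_unitExp]
    linarith
  have h3 : ‖I‖ ≤ X ^ ε * |τ| ^ (ε - 1) := by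
    calc ‖I‖ = ‖I‖ ^ ε * ‖I‖ ^ (1 - ε) := by
          rw [← Real.rpow_add_of_nonneg (norm_nonneg _) hε.le (by linarith)]; simp
      _ ≤ X ^ ε * (|τ|⁻¹) ^ (1 - ε) := by
          gcongr
      _ = _ := by
          rw [Real.inv_rpow hτ'.le, ← Real.rpow_neg hτ'.le, neg_sub]
  rw [cutoffTransform, norm_mul, Complex.norm_real, Real.norm_of_nonneg (Real.exp_nonneg _)]
  calc _ ≤ Real.exp (-(Real.pi * R ^ 2) * τ ^ 2) * (X ^ ε * |τ| ^ (ε - 1)) := by gcongr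
    _ = _ := by ring

/-! ### Averaging the Weyl bounds over all frequencies -/

lemma integrable_abs_rpow_mul_exp {b s : ℝ} (hb : 0 < b) (hs : -1 < s) :
    Integrable fun x : ℝ => |x| ^ s * Real.exp (-b * x ^ 2) := by
  have h1 : IntegrableOn (fun x : ℝ => |x| ^ s * Real.exp (-b * x ^ 2)) (Set.Ioi 0) := by
    refine (integrableOn_rpow_mul_exp_neg_mul_sq hb hs).congr_fun (fun x hx => ?_) measurableSet_Ioi
    dsimp only
    rw [abs_of_pos hx]
  have h2 : IntegrableOn (fun x : ℝ => |x| ^ s * Real.exp (-b * x ^ 2)) (Set.Iio 0) := by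
    have := h1.comp_neg
    simpa using this
  have h3 := (Iff.mpr integrableOn_Iic_iff_integrableOn_Iio h2).union h1
  rwa [Set.Iic_union_Ioi, integrableOn_univ] at h3

lemma integrable_weight_mul_spike {b s : ℝ} (hb : 0 < b) (hs : -1 < s) (L : ℕ) (p q : ℝ) :
    Integrable fun x : ℝ => |x| ^ s * Real.exp (-b * x ^ 2) * spike L (p * x + q) := by
  refine (integrable_abs_rpow_mul_exp hb hs).mul_bdd (c := 2 * L) ?_ ?_
  · exact ((continuous_spike L).comp (by fun_prop)).aestronglyMeasurable
  · refine Filter.Eventually.of_forall fun x => ?_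
    rw [Real.norm_of_nonneg (spike_nonneg _ _)]
    exact spike_le _ _

/-- The substitution `u = k τ`. -/
lemma integral_weight_mul_spike_le {R C₁ ε : ℝ} {k L : ℕ} (hR : 0 < R) (hC₁ : 0 < C₁)
    (hε : 0 < ε) (hk : 1 ≤ k) (hkL : k ≤ C₁ * R) (p q : ℝ) :
    ∫ τ : ℝ, |τ| ^ (ε - 1) * Real.exp (-(Real.pi * R ^ 2) * τ ^ 2) * spike L (p * (k * τ) + q)
      ≤ ∫ u : ℝ, |u| ^ (ε - 1) * Real.exp (-(Real.pi / C₁ ^ 2) * u ^ 2) * spike L (p * u + q) := by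
  have hk0 : (0 : ℝ) < k := by exact_mod_cast hk
  have hk1 : (1 : ℝ) ≤ k := by exact_mod_cast hk
  have hπ := Real.pi_pos
  have h := Measure.integral_comp_mul_left (fun u : ℝ => (|u| / k) ^ (ε - 1) *
    Real.exp (-(Real.pi * R ^ 2 / k ^ 2) * u ^ 2) * spike L (p * u + q)) (k : ℝ)
  have h1 : ∀ τ : ℝ, (|↑k * τ| / k) ^ (ε - 1) *
      Real.exp (-(Real.pi * R ^ 2 / k ^ 2) * (k * τ) ^ 2) * spike L (p * (k * τ) + q)
      = |τ| ^ (ε - 1) * Real.exp (-(Real.pi * R ^ 2) * τ ^ 2) * spike L (p * (k * τ) + q) := by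
    intro τ
    rw [abs_mul, abs_of_pos hk0, mul_div_cancel_left₀ _ hk0.ne']
    congr 3
    field_simp
  simp_rw [h1] at h
  rw [h, smul_eq_mul, ← integral_const_mul]
  refine integral_mono_of_nonneg ?_ (integrable_weight_mul_spike (by positivity) (by linarith) L p q)
    (Filter.Eventually.of_forall fun u => ?_)
  · refine Filter.Eventually.of_forall fun u => ?_
    have := spike_nonneg L (p * u + q)
    simp only [Pi.zero_apply]
    positivity
  · have h0 := spike_nonneg L (p * u + q)
    have h2 : Real.exp (-(Real.pi * R ^ 2 / k ^ 2) * u ^ 2) ≤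
        Real.exp (-(Real.pi / C₁ ^ 2) * u ^ 2) := by
      apply Real.exp_le_exp.mpr
      apply mul_le_mul_of_nonneg_right _ (sq_nonneg u)
      rw [neg_le_neg_iff, div_le_div_iff₀ (by positivity) (by positivity), mul_assoc]
      apply mul_le_mul_of_nonneg_left _ hπ.le
      rw [← mul_pow, mul_comm R]
      gcongr
    -- The Jacobian `k⁻¹` and the weight combine to the factor `k ^ (-ε) ≤ 1`.
    have h3 : |(k : ℝ)⁻¹| * (|u| / k) ^ (ε - 1) ≤ |u| ^ (ε - 1) := by
      rw [Real.div_rpow (abs_nonneg u) hk0.le, abs_of_pos (by positivity), div_eq_mul_inv,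
        ← Real.rpow_neg hk0.le, ← Real.rpow_neg_one, mul_left_comm, ← Real.rpow_add hk0]
      apply mul_le_of_le_one_right (by positivity)
      apply Real.rpow_le_one_of_one_le_of_nonpos hk1
      linarith
    dsimp only
    rw [← mul_assoc, ← mul_assoc]
    gcongr

/-- The weighted mean of the Weyl bounds over all frequencies. -/
lemma sum_integral_weyl_le (A C₁ ε : ℝ) (hA : 0 < A) (hC₁ : 0 < C₁) (hε : 0 < ε) :
    ∃ C : ℝ, 0 ≤ C ∧ ∀ (R : ℝ) (L H : ℕ), 1 < R → L ≤ C₁ * R →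
      ∑ h ∈ Finset.Ico 1 H, (h : ℝ) ^ (-1 - ε) *
        ∫ τ : ℝ, |τ| ^ (ε - 1) * Real.exp (-(Real.pi * R ^ 2) * τ ^ 2) *
          (L + 2 * ∑ k ∈ Finset.Ico 1 L, spike L (2 * ((τ - h / R) * A) * k))
        ≤ C * R ^ (1 + 2 * ε) := by
  obtain ⟨C₂, hC₂, hdouble⟩ := sum_sum_spike_le A C₁ ε hA hC₁ hε
  have hπ := Real.pi_pos
  set W₀ := ∫ u : ℝ, |u| ^ (ε - 1) * Real.exp (-Real.pi * u ^ 2) with hW₀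
  set W₁ := ∫ u : ℝ, |u| ^ (ε - 1) * Real.exp (-(Real.pi / C₁ ^ 2) * u ^ 2) with hW₁
  have hW₀0 : 0 ≤ W₀ := integral_nonneg fun u => by positivity
  have hW₁0 : 0 ≤ W₁ := integral_nonneg fun u => by positivity
  have hsum : Summable fun h : ℕ => (h : ℝ) ^ (-1 - ε) :=
    Real.summable_nat_rpow.mpr (by linarith)
  set Z := ∑' h : ℕ, (h : ℝ) ^ (-1 - ε) with hZ
  have hZ0 : 0 ≤ Z := tsum_nonneg fun b => by positivity
  refine ⟨Z * (W₀ * C₁) + 2 * (W₁ * C₂), by positivity, fun R L H hR hL => ?_⟩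
  have hR0 : 0 < R := by linarith
  have hi₀ : Integrable fun τ : ℝ => |τ| ^ (ε - 1) * Real.exp (-(Real.pi * R ^ 2) * τ ^ 2) :=
    integrable_abs_rpow_mul_exp (by positivity) (by linarith)
  have hmono : ∫ τ : ℝ, |τ| ^ (ε - 1) * Real.exp (-(Real.pi * R ^ 2) * τ ^ 2) ≤ W₀ := by
    refine integral_mono hi₀ (integrable_abs_rpow_mul_exp hπ (by linarith)) fun u => ?_
    dsimp only
    have : 1 ≤ R ^ 2 := one_le_pow₀ hR.le
    gcongr
    nlinarith
  have hi : ∀ (h k : ℕ), Integrable fun τ : ℝ =>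
      |τ| ^ (ε - 1) * Real.exp (-(Real.pi * R ^ 2) * τ ^ 2) *
        spike L (2 * ((τ - h / R) * A) * k) := by
    intro h k
    refine (integrable_weight_mul_spike (b := Real.pi * R ^ 2) (s := ε - 1) (by positivity)
      (by linarith) L (2 * A * k) (-(2 * (h / R * A) * k))).congr
      (Filter.Eventually.of_forall fun τ => ?_)
    dsimp only
    ring_nf
  have hexpand : ∀ h : ℕ, ∫ τ : ℝ, |τ| ^ (ε - 1) * Real.exp (-(Real.pi * R ^ 2) * τ ^ 2) *
          (L + 2 * ∑ k ∈ Finset.Ico 1 L, spike L (2 * ((τ - h / R) * A) * k))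
      = L * (∫ τ : ℝ, |τ| ^ (ε - 1) * Real.exp (-(Real.pi * R ^ 2) * τ ^ 2)) +
        2 * ∑ k ∈ Finset.Ico 1 L, ∫ τ : ℝ, |τ| ^ (ε - 1) *
          Real.exp (-(Real.pi * R ^ 2) * τ ^ 2) * spike L (2 * ((τ - h / R) * A) * k) := by
    intro h
    rw [← integral_finsetSum _ fun k _ => hi h k, ← integral_const_mul, ← integral_const_mul,
      ← integral_add (hi₀.const_mul _) ((integrable_finsetSum _ fun k _ => hi h k).const_mul _)]
    congr 1
    ext τ
    rw [← Finset.mul_sum]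
    ring
  have hsub : ∀ h : ℕ, ∀ k ∈ Finset.Ico 1 L, ∫ τ : ℝ, |τ| ^ (ε - 1) *
          Real.exp (-(Real.pi * R ^ 2) * τ ^ 2) * spike L (2 * ((τ - h / R) * A) * k)
      ≤ ∫ u : ℝ, |u| ^ (ε - 1) * Real.exp (-(Real.pi / C₁ ^ 2) * u ^ 2) *
        spike L (2 * A * u + -(2 * A / R * (h * k : ℕ))) := by
    intro h k hk
    rw [Finset.mem_Ico] at hk
    have hkL : (k : ℝ) ≤ C₁ * R := le_trans (by exact_mod_cast hk.2.le) hL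
    refine le_trans (le_of_eq ?_) (integral_weight_mul_spike_le hR0 hC₁ hε hk.1 hkL _ _)
    congr 1
    ext τ
    congr 2
    push_cast
    ring
  have hi₂ : ∀ h k : ℕ, Integrable fun u : ℝ =>
      |u| ^ (ε - 1) * Real.exp (-(Real.pi / C₁ ^ 2) * u ^ 2) *
        spike L (2 * A * u + -(2 * A / R * (h * k : ℕ))) := fun h k =>
    integrable_weight_mul_spike (by positivity) (by linarith) L _ _
  -- For fixed `u` the phase involves `h` and `k` only through `h * k`, and the double-sum bound is
  -- uniform in the shift `2 * A * u`, so it can be integrated over `u`.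
  have hpt : ∀ u : ℝ, ∑ h ∈ Finset.Ico 1 H, ∑ k ∈ Finset.Ico 1 L, (h : ℝ) ^ (-1 - ε) *
      spike L (2 * A * u + -(2 * A / R * (h * k : ℕ))) ≤ C₂ * R ^ (1 + 2 * ε) := by
    intro u
    refine le_trans (le_of_eq ?_) (hdouble R L H (-(2 * A * u)) hR hL)
    refine Finset.sum_congr rfl fun h _ => Finset.sum_congr rfl fun k _ => ?_
    rw [← spike_neg]
    congr 2
    ring
  have hmain : ∑ h ∈ Finset.Ico 1 H, ∑ k ∈ Finset.Ico 1 L, (h : ℝ) ^ (-1 - ε) *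
      ∫ u : ℝ, |u| ^ (ε - 1) * Real.exp (-(Real.pi / C₁ ^ 2) * u ^ 2) *
        spike L (2 * A * u + -(2 * A / R * (h * k : ℕ))) ≤ W₁ * (C₂ * R ^ (1 + 2 * ε)) := by
    simp_rw [← integral_const_mul]
    rw [Finset.sum_congr rfl fun h _ =>
      (integral_finsetSum (Finset.Ico 1 L) fun k _ => (hi₂ h k).const_mul ((h : ℝ) ^ (-1 - ε))).symm,
      ← integral_finsetSum _ fun h _ => integrable_finsetSum _ fun k _ => (hi₂ h k).const_mul _,
      hW₁, ← integral_mul_const]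
    refine integral_mono (integrable_finsetSum _ fun h _ => integrable_finsetSum _ fun k _ =>
      (hi₂ h k).const_mul _) ((integrable_abs_rpow_mul_exp (by positivity)
        (by linarith)).mul_const _) fun u => ?_
    dsimp only
    refine le_trans (le_of_eq ?_) (mul_le_mul_of_nonneg_left (hpt u) (by positivity))
    rw [Finset.mul_sum]
    refine Finset.sum_congr rfl fun h _ => ?_
    rw [Finset.mul_sum]
    refine Finset.sum_congr rfl fun k _ => ?_
    ring
  calc _ ≤ ∑ h ∈ Finset.Ico 1 H, ((h : ℝ) ^ (-1 - ε) * (W₀ * (C₁ * R)) +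
        2 * ∑ k ∈ Finset.Ico 1 L, (h : ℝ) ^ (-1 - ε) *
      ∫ u : ℝ, |u| ^ (ε - 1) * Real.exp (-(Real.pi / C₁ ^ 2) * u ^ 2) *
        spike L (2 * A * u + -(2 * A / R * (h * k : ℕ)))) := by
        refine Finset.sum_le_sum fun h _ => ?_
        rw [hexpand h, ← Finset.mul_sum, mul_left_comm 2, ← mul_add]
        refine mul_le_mul_of_nonneg_left (add_le_add ?_ (mul_le_mul_of_nonneg_left
          (Finset.sum_le_sum fun k hk => hsub h k hk) (by norm_num))) (by positivity)
        rw [mul_comm W₀]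
        gcongr
    _ ≤ Z * (W₀ * (C₁ * R ^ (1 + 2 * ε))) + 2 * (W₁ * (C₂ * R ^ (1 + 2 * ε))) := by
        rw [Finset.sum_add_distrib, ← Finset.sum_mul, ← Finset.mul_sum]
        have h1 : R ≤ R ^ (1 + 2 * ε) := by
          conv_lhs => rw [← Real.rpow_one R]
          exact Real.rpow_le_rpow_of_exponent_le hR.le (by linarith)
        gcongr
        exact hsum.sum_le_tsum _ fun b _ => by positivity
    _ = _ := by ring

/-! ### The sawtooth function and its Fourier expansion -/

/-- The sawtooth function. -/
def sawtooth (s : ℝ) : ℝ := Int.fract s - 1 / 2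

/-- A primitive of `sawtooth`. -/
def sawtoothPrimitive (s : ℝ) : ℝ := (Int.fract s ^ 2 - Int.fract s) / 2

lemma abs_sawtooth_le (s : ℝ) : |sawtooth s| ≤ 1 / 2 := by
  have h1 := Int.fract_nonneg s
  have h2 := Int.fract_lt_one s
  rw [sawtooth, abs_le]
  constructor <;> linarith

/-- The sawtooth rises with slope `1` and jumps only downwards, so on `[s - η, s]` it is at least
`sawtooth s - η`; the quotient is its mean there. `le_sawtooth` is the same argument to the right of
`s`. -/
lemma sawtooth_le {s η : ℝ} (hη : 0 < η) (hη1 : η ≤ 1) :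
    sawtooth s ≤ (sawtoothPrimitive s - sawtoothPrimitive (s - η)) / η + η := by
  have h1 := Int.fract_nonneg s
  have h2 := Int.fract_lt_one s
  suffices h : η * (sawtooth s - η) ≤ sawtoothPrimitive s - sawtoothPrimitive (s - η) by
    have : sawtooth s - η ≤ (sawtoothPrimitive s - sawtoothPrimitive (s - η)) / η := by
      rw [le_div_iff₀ hη]; linarith
    linarith
  unfold sawtooth sawtoothPrimitive
  rcases le_or_gt η (Int.fract s) with h | h
  · have h3 : Int.fract (s - η) = Int.fract s - η := by
      rw [Int.fract_eq_iff]
      exact ⟨by linarith, by linarith, ⌊s⌋, by rw [Int.fract]; ring⟩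
    rw [h3]; nlinarith
  · have h3 : Int.fract (s - η) = Int.fract s - η + 1 := by
      rw [Int.fract_eq_iff]
      exact ⟨by linarith, by linarith, ⌊s⌋ - 1, by rw [Int.fract]; push_cast; ring⟩
    rw [h3]; nlinarith

lemma le_sawtooth {s η : ℝ} (hη : 0 < η) (hη1 : η ≤ 1) :
    (sawtoothPrimitive (s + η) - sawtoothPrimitive s) / η - η ≤ sawtooth s := by
  have h1 := Int.fract_nonneg s
  have h2 := Int.fract_lt_one s
  suffices h : sawtoothPrimitive (s + η) - sawtoothPrimitive s ≤ η * (sawtooth s + η) by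
    have : (sawtoothPrimitive (s + η) - sawtoothPrimitive s) / η ≤ sawtooth s + η := by
      rw [div_le_iff₀ hη]; linarith
    linarith
  unfold sawtooth sawtoothPrimitive
  rcases lt_or_ge (Int.fract s + η) 1 with h | h
  · have h3 : Int.fract (s + η) = Int.fract s + η := by
      rw [Int.fract_eq_iff]
      exact ⟨by linarith, by linarith, ⌊s⌋, by rw [Int.fract]; ring⟩
    rw [h3]; nlinarith
  · have h3 : Int.fract (s + η) = Int.fract s + η - 1 := by
      rw [Int.fract_eq_iff]
      exact ⟨by linarith, by linarith, ⌊s⌋ + 1, by rw [Int.fract]; push_cast; ring⟩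
    rw [h3]; nlinarith

/-- The Fourier series of the Bernoulli polynomial `B₂ = x ^ 2 - x + 1 / 6` at the fractional part.
Passing to the primitive makes the series absolutely convergent. -/
lemma hasSum_sawtoothPrimitive (s : ℝ) :
    HasSum (fun h : ℕ => 1 / (h : ℝ) ^ 2 * Real.cos (2 * Real.pi * h * s))
      (2 * Real.pi ^ 2 * sawtoothPrimitive s + Real.pi ^ 2 / 6) := by
  have h := hasSum_one_div_nat_pow_mul_cos (k := 1) (by norm_num) (x := Int.fract s)
    ⟨Int.fract_nonneg s, (Int.fract_lt_one s).le⟩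
  convert h using 1
  · ext n
    rw [mul_one]
    congr 1
    have : 2 * Real.pi * n * s = 2 * Real.pi * n * Int.fract s + (n * ⌊s⌋ : ℤ) * (2 * Real.pi) := by
      rw [Int.fract]; push_cast; ring
    rw [this, Real.cos_add_int_mul_two_pi]
  · have h2 : Polynomial.bernoulli 2
        = Polynomial.X ^ 2 - Polynomial.X + Polynomial.C (1 / 6 : ℚ) := by
      simp [Polynomial.bernoulli, Finset.sum_range_succ, ← Polynomial.C_mul_X_pow_eq_monomial]
      ring_nf
      simp
      ring_nf
      rw [mul_right_comm, show (2 : Polynomial ℚ) = Polynomial.C 2 from (map_ofNat _ 2).symm,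
        ← Polynomial.C_mul]
      norm_num
    rw [mul_one, h2]
    simp [sawtoothPrimitive, Nat.factorial]
    ring

lemma re_unitExp (x : ℝ) : (unitExp x).re = Real.cos (2 * Real.pi * x) := by
  have : (2 * Real.pi * x * Complex.I : ℂ) = ((2 * Real.pi * x : ℝ) : ℂ) * Complex.I := by
    push_cast; ring
  rw [unitExp, this, Complex.exp_ofReal_mul_I_re]

/-- Interpolation, with exponents `ε` and `1 - ε`, between `R / h ^ 2`, from the trivial bound `2`
for the norm, and `1 / h`, from the small step `1 / R`. -/
lemma frequencyWeight_le {R ε : ℝ} (hR : 1 < R) (hε : 0 < ε) (hε1 : ε < 1) {h : ℕ} (hh : 1 ≤ h) :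
    R / (2 * Real.pi ^ 2 * h ^ 2) * ‖unitExp (h * (1 / R)) - 1‖ ≤ R ^ ε * (h : ℝ) ^ (-1 - ε) := by
  have hR0 : 0 < R := by linarith
  have hh0 : (0 : ℝ) < h := by exact_mod_cast hh
  have hπ := Real.pi_gt_three
  set w := R / (2 * Real.pi ^ 2 * h ^ 2) * ‖unitExp (h * (1 / R)) - 1‖ with hw
  have hw0 : 0 ≤ w := by positivity
  have h1 : w ≤ R / h ^ 2 := by
    have h2 : ‖unitExp (h * (1 / R)) - 1‖ ≤ 2 := by
      refine (norm_sub_le _ _).trans ?_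
      rw [norm_unitExp]; norm_num
    calc w ≤ R / (2 * Real.pi ^ 2 * h ^ 2) * 2 := by rw [hw]; gcongr
      _ = R / h ^ 2 * (1 / Real.pi ^ 2) := by field_simp
      _ ≤ R / h ^ 2 * 1 := by
          gcongr
          rw [div_le_one (by positivity)]
          nlinarith
      _ = _ := mul_one _
  have h2 : w ≤ (h : ℝ)⁻¹ := by
    have h3 := norm_unitExp_sub_one_le (h * (1 / R))
    rw [abs_of_nonneg (by positivity)] at h3
    calc w ≤ R / (2 * Real.pi ^ 2 * h ^ 2) * (2 * Real.pi * (h * (1 / R))) := by rw [hw]; gcongr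
      _ = (h : ℝ)⁻¹ * (1 / Real.pi) := by field_simp
      _ ≤ (h : ℝ)⁻¹ * 1 := by
          gcongr
          rw [div_le_one (by positivity)]
          linarith
      _ = _ := mul_one _
  calc w = w ^ ε * w ^ (1 - ε) := by
        rw [← Real.rpow_add_of_nonneg hw0 hε.le (by linarith)]; simp
    _ ≤ (R / h ^ 2) ^ ε * ((h : ℝ)⁻¹) ^ (1 - ε) := by
        gcongr
    _ = R ^ ε * ((h : ℝ) ^ (-(2 * ε)) * (h : ℝ) ^ (-(1 - ε))) := by
        rw [Real.div_rpow hR0.le (by positivity), Real.inv_rpow hh0.le, ← Real.rpow_neg hh0.le,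
          ← Real.rpow_natCast, ← Real.rpow_mul hh0.le, div_eq_mul_inv, ← Real.rpow_neg hh0.le]
        push_cast
        ring
    _ = _ := by
        rw [← Real.rpow_add hh0]
        ring_nf

/-- Fourier expansion of a weighted sum of differences of `sawtoothPrimitive`. -/
lemma abs_sum_sawtoothPrimitive_le {ι : Type*} (s : Finset ι) (w t : ι → ℝ) {R ε M : ℝ} (X σ : ℝ)
    (hR : 1 < R) (hε : 0 < ε) (hε1 : ε < 1)
    (hM : ∀ H : ℕ, ∑ h ∈ Finset.Ico 1 H, (h : ℝ) ^ (-1 - ε) *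
      ‖∑ n ∈ s, (w n : ℂ) * unitExp (-(h / R) * t n)‖ ≤ M) :
    |∑ n ∈ s, w n * ((sawtoothPrimitive ((X - t n) / R + σ + 1 / R) -
      sawtoothPrimitive ((X - t n) / R + σ)) / (1 / R))| ≤ R ^ ε * M := by
  have hR0 : 0 < R := by linarith
  have hπ := Real.pi_pos
  set D : ℕ → ℝ := fun h => ∑ n ∈ s, w n * (R / (2 * Real.pi ^ 2) *
    (1 / (h : ℝ) ^ 2 * Real.cos (2 * Real.pi * h * ((X - t n) / R + σ + 1 / R)) -
     1 / (h : ℝ) ^ 2 * Real.cos (2 * Real.pi * h * ((X - t n) / R + σ)))) with hD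
  have hsum : HasSum D (∑ n ∈ s, w n * ((sawtoothPrimitive ((X - t n) / R + σ + 1 / R) -
      sawtoothPrimitive ((X - t n) / R + σ)) / (1 / R))) := by
    refine hasSum_sum fun n _ => HasSum.mul_left _ ?_
    have := ((hasSum_sawtoothPrimitive ((X - t n) / R + σ + 1 / R)).sub
      (hasSum_sawtoothPrimitive ((X - t n) / R + σ))).mul_left (R / (2 * Real.pi ^ 2))
    convert this using 1
    field_simp
    ring
  have hterm : ∀ h : ℕ, 1 ≤ h → |D h| ≤ R ^ ε * ((h : ℝ) ^ (-1 - ε) *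
      ‖∑ n ∈ s, (w n : ℂ) * unitExp (-(h / R) * t n)‖) := by
    intro h hh
    have hh0 : (0 : ℝ) < h := by exact_mod_cast hh
    set S := ∑ n ∈ s, (w n : ℂ) * unitExp (-(h / R) * t n) with hS
    have h1 : D h = R / (2 * Real.pi ^ 2 * h ^ 2) *
        ((unitExp (h * (1 / R)) - 1) * unitExp (h * (X / R + σ)) * S).re := by
      rw [hS, Finset.mul_sum, Complex.re_sum, Finset.mul_sum, hD]
      refine Finset.sum_congr rfl fun n _ => ?_
      have h2 : (unitExp (h * (1 / R)) - 1) * unitExp (h * (X / R + σ)) *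
          ((w n : ℂ) * unitExp (-(h / R) * t n)) = (w n : ℂ) *
          (unitExp (h * ((X - t n) / R + σ + 1 / R)) - unitExp (h * ((X - t n) / R + σ))) := by
        have e1 : unitExp (h * ((X - t n) / R + σ)) =
            unitExp (h * (X / R + σ)) * unitExp (-(h / R) * t n) := by
          rw [← unitExp_add]; congr 1; ring
        have e2 : unitExp (h * ((X - t n) / R + σ + 1 / R)) =
            unitExp (h * (1 / R)) * unitExp (h * ((X - t n) / R + σ)) := by
          rw [← unitExp_add]; congr 1; ring
        rw [e2, e1]; ring
      rw [h2, Complex.re_ofReal_mul, Complex.sub_re, re_unitExp, re_unitExp, ← mul_assoc (2 * Real.pi),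
        ← mul_assoc (2 * Real.pi)]
      field_simp
    rw [h1, abs_mul, abs_of_nonneg (by positivity)]
    calc _ ≤ R / (2 * Real.pi ^ 2 * h ^ 2) *
          ‖(unitExp (h * (1 / R)) - 1) * unitExp (h * (X / R + σ)) * S‖ := by
          gcongr
          exact Complex.abs_re_le_norm _
      _ = R / (2 * Real.pi ^ 2 * h ^ 2) * ‖unitExp (h * (1 / R)) - 1‖ * ‖S‖ := by
          rw [norm_mul, norm_mul, norm_unitExp]; ring
      _ ≤ R ^ ε * (h : ℝ) ^ (-1 - ε) * ‖S‖ := by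
          exact mul_le_mul_of_nonneg_right (frequencyWeight_le hR hε hε1 hh) (norm_nonneg _)
      _ = _ := by ring
  refine le_of_tendsto hsum.tendsto_sum_nat.abs (Filter.Eventually.of_forall fun H => ?_)
  -- The series is indexed from `h = 0`, where `1 / 0 ^ 2 = 0`.
  have hD0 : D 0 = 0 := by simp [hD]
  have h3 : ∑ h ∈ Finset.range H, D h = ∑ h ∈ Finset.Ico 1 H, D h := by
    rcases Nat.eq_zero_or_pos H with rfl | hH
    · simp
    · rw [Finset.range_eq_Ico, Finset.sum_eq_sum_Ico_succ_bot hH, hD0, zero_add]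
  rw [h3]
  calc |∑ h ∈ Finset.Ico 1 H, D h| ≤ ∑ h ∈ Finset.Ico 1 H, |D h| := Finset.abs_sum_le_sum_abs _ _
    _ ≤ ∑ h ∈ Finset.Ico 1 H, R ^ ε * ((h : ℝ) ^ (-1 - ε) *
      ‖∑ n ∈ s, (w n : ℂ) * unitExp (-(h / R) * t n)‖) :=
        Finset.sum_le_sum fun h hh => hterm h (Finset.mem_Ico.mp hh).1
    _ ≤ _ := by
        rw [← Finset.mul_sum]
        gcongr
        exact hM H

/-! ### Smoothly cut off sawtooth sums for binary diagonal forms -/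

/-- Fourier inversion removes the cutoff: the weighted sum at frequency `-θ` is an average of
unweighted sums at the frequencies `τ - θ`. -/
lemma norm_sum_smoothCutoff_le {ι : Type*} (s : Finset ι) (t : ι → ℝ) {R X ε θ : ℝ}
    (hR : 0 < R) (hX : 0 ≤ X) (hε : 0 < ε) (hε1 : ε < 1) (F : ℝ → ℝ)
    (hF : ∀ τ, ‖∑ n ∈ s, unitExp ((τ - θ) * t n)‖ ≤ F τ)
    (hFi : Integrable fun τ => |τ| ^ (ε - 1) * Real.exp (-(Real.pi * R ^ 2) * τ ^ 2) * F τ) :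
    ‖∑ n ∈ s, (smoothCutoff R X (t n) : ℂ) * unitExp (-θ * t n)‖ ≤
      X ^ ε * ∫ τ, |τ| ^ (ε - 1) * Real.exp (-(Real.pi * R ^ 2) * τ ^ 2) * F τ := by
  have hi₀ : Integrable (cutoffTransform R X) := by
    refine Integrable.mono' (g := fun τ => X ^ ε * (|τ| ^ (ε - 1) *
      Real.exp (-(Real.pi * R ^ 2) * τ ^ 2))) ?_ (continuous_cutoffTransform R X).aestronglyMeasurable ?_
    · exact (integrable_abs_rpow_mul_exp (by have := Real.pi_pos; positivity) (by linarith)).const_mul _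
    · filter_upwards [Measure.ae_ne volume (0 : ℝ)] with τ hτ
      exact norm_cutoffTransform_le hX hε hε1 hτ
  have hi : ∀ c d : ℝ, Integrable fun τ => cutoffTransform R X τ * unitExp (τ * c + d) := by
    intro c d
    refine hi₀.mul_bdd (c := 1) ?_ (Filter.Eventually.of_forall fun τ => (norm_unitExp _).le)
    exact (continuous_unitExp.comp (by fun_prop)).aestronglyMeasurable
  have h1 : ∑ n ∈ s, (smoothCutoff R X (t n) : ℂ) * unitExp (-θ * t n)
      = ∫ τ, cutoffTransform R X τ * ∑ n ∈ s, unitExp ((τ - θ) * t n) := by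
    simp_rw [Finset.mul_sum]
    have : ∀ τ n, (τ - θ) * t n = τ * t n + -θ * t n := fun τ n => by ring
    simp_rw [this]
    rw [integral_finsetSum _ fun n _ => hi _ _]
    refine Finset.sum_congr rfl fun n _ => ?_
    rw [smoothCutoff_eq hR, ← integral_mul_const]
    congr 1
    ext τ
    rw [unitExp_add]; ring
  rw [h1, ← integral_const_mul]
  refine norm_integral_le_of_norm_le (hFi.const_mul _) ?_
  filter_upwards [Measure.ae_ne volume (0 : ℝ)] with τ hτ
  rw [norm_mul, ← mul_assoc]
  gcongr
  · exact norm_cutoffTransform_le hX hε hε1 hτ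
  · exact hF τ

/-- The values of a binary diagonal form at the points of a shifted square lattice. -/
def diagForm (A B γ δ : ℝ) (n : ℕ × ℕ) : ℝ := A * (n.1 + γ) ^ 2 + B * (n.2 + δ) ^ 2

/-- For a diagonal form the sum over a box is a product of two one-variable sums. Since `a * b ≤ a ^
2 + b ^ 2`, Weyl's bound for each square applies, and the variables `A` and `B` separate. -/
lemma norm_sum_diagForm_le (A B γ δ θ : ℝ) (L : ℕ) :
    ‖∑ n ∈ Finset.range L ×ˢ Finset.range L, unitExp (θ * diagForm A B γ δ n)‖ ≤
      (L + 2 * ∑ k ∈ Finset.Ico 1 L, spike L (2 * (θ * A) * k)) +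
      (L + 2 * ∑ k ∈ Finset.Ico 1 L, spike L (2 * (θ * B) * k)) := by
  have h1 := norm_sq_sum_quadratic_le L (θ * A) γ
  have h2 := norm_sq_sum_quadratic_le L (θ * B) δ
  have h3 : ∑ n ∈ Finset.range L ×ˢ Finset.range L, unitExp (θ * diagForm A B γ δ n)
      = (∑ i ∈ Finset.range L, unitExp (θ * A * (i + γ) ^ 2)) *
        ∑ j ∈ Finset.range L, unitExp (θ * B * (j + δ) ^ 2) := by
    rw [Finset.sum_mul_sum, ← Finset.sum_product']
    refine Finset.sum_congr rfl fun n _ => ?_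
    rw [← unitExp_add, diagForm]
    congr 1; ring
  rw [h3, norm_mul]
  nlinarith [sq_nonneg (‖∑ i ∈ Finset.range L, unitExp (θ * A * (i + γ) ^ 2)‖ -
    ‖∑ j ∈ Finset.range L, unitExp (θ * B * (j + δ) ^ 2)‖),
    sq_nonneg (‖∑ i ∈ Finset.range L, unitExp (θ * A * (i + γ) ^ 2)‖),
    sq_nonneg (‖∑ j ∈ Finset.range L, unitExp (θ * B * (j + δ) ^ 2)‖)]

lemma integrable_weight_mul_weyl {R ε : ℝ} (hR : 0 < R) (hε : 0 < ε) (L : ℕ) (A θ : ℝ) :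
    Integrable fun τ : ℝ => |τ| ^ (ε - 1) * Real.exp (-(Real.pi * R ^ 2) * τ ^ 2) *
      (L + 2 * ∑ k ∈ Finset.Ico 1 L, spike L (2 * ((τ - θ) * A) * k)) := by
  have hb : 0 < Real.pi * R ^ 2 := by have := Real.pi_pos; positivity
  have h1 := (integrable_abs_rpow_mul_exp hb (show -1 < ε - 1 by linarith)).mul_const (L : ℝ)
  have h2 : ∀ k ∈ Finset.Ico 1 L, Integrable fun τ : ℝ => |τ| ^ (ε - 1) *
      Real.exp (-(Real.pi * R ^ 2) * τ ^ 2) * spike L (2 * ((τ - θ) * A) * k) := by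
    intro k _
    refine (integrable_weight_mul_spike hb (show -1 < ε - 1 by linarith) L (2 * A * k)
      (-(2 * (θ * A) * k))).congr (Filter.Eventually.of_forall fun τ => ?_)
    dsimp only
    ring_nf
  refine (h1.add ((integrable_finsetSum _ h2).const_mul 2)).congr
    (Filter.Eventually.of_forall fun τ => ?_)
  rw [Pi.add_apply]
  dsimp only
  rw [← Finset.mul_sum]
  ring

lemma smooth_sawtooth_sum_le (A B c₀ C₁ ε : ℝ) (hA : 0 < A) (hB : 0 < B) (hc₀ : 0 < c₀)
    (hC₁ : 0 < C₁) (hε : 0 < ε) (hε1 : ε < 1) :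
    ∃ C : ℝ, 0 ≤ C ∧ ∀ (R X γ δ : ℝ) (L : ℕ), 1 < R → 0 ≤ X → X ≤ c₀ * R ^ 2 → L ≤ C₁ * R →
      |∑ n ∈ Finset.range L ×ˢ Finset.range L, smoothCutoff R X (diagForm A B γ δ n) *
        sawtooth ((X - diagForm A B γ δ n) / R)| ≤ C * R ^ (1 + 5 * ε) := by
  obtain ⟨CA, hCA, hWA⟩ := sum_integral_weyl_le A C₁ ε hA hC₁ hε
  obtain ⟨CB, hCB, hWB⟩ := sum_integral_weyl_le B C₁ ε hB hC₁ hε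
  refine ⟨c₀ ^ ε * (CA + CB) + C₁ ^ 2, by positivity, fun R X γ δ L hR hX hXR hL => ?_⟩
  have hR0 : 0 < R := by linarith
  set s := Finset.range L ×ˢ Finset.range L with hs
  set t : ℕ × ℕ → ℝ := diagForm A B γ δ with ht
  set w : ℕ × ℕ → ℝ := fun n => smoothCutoff R X (t n) with hw
  have hw0 : ∀ n, 0 ≤ w n := fun n => smoothCutoff_nonneg hR0 hX
  have hw1 : ∀ n, w n ≤ 1 := fun n => smoothCutoff_le_one hR0 hX
  set M := X ^ ε * ((CA + CB) * R ^ (1 + 2 * ε)) with hM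
  have hfreq : ∀ H : ℕ, ∑ h ∈ Finset.Ico 1 H, (h : ℝ) ^ (-1 - ε) *
      ‖∑ n ∈ s, (w n : ℂ) * unitExp (-(h / R) * t n)‖ ≤ M := by
    intro H
    have h1 : ∀ h : ℕ, ‖∑ n ∈ s, (w n : ℂ) * unitExp (-(h / R) * t n)‖ ≤ X ^ ε *
        ((∫ τ, |τ| ^ (ε - 1) * Real.exp (-(Real.pi * R ^ 2) * τ ^ 2) *
          (L + 2 * ∑ k ∈ Finset.Ico 1 L, spike L (2 * ((τ - h / R) * A) * k))) +
        ∫ τ, |τ| ^ (ε - 1) * Real.exp (-(Real.pi * R ^ 2) * τ ^ 2) *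
          (L + 2 * ∑ k ∈ Finset.Ico 1 L, spike L (2 * ((τ - h / R) * B) * k))) := by
      intro h
      have hiA := integrable_weight_mul_weyl hR0 hε L A (h / R)
      have hiB := integrable_weight_mul_weyl hR0 hε L B (h / R)
      rw [← integral_add hiA hiB]
      simp_rw [← mul_add]
      refine norm_sum_smoothCutoff_le s t hR0 hX hε hε1 _
        (fun τ => norm_sum_diagForm_le A B γ δ (τ - h / R) L) ?_
      simp_rw [mul_add] at hiA hiB ⊢
      exact hiA.add hiB
    calc _ ≤ ∑ h ∈ Finset.Ico 1 H, (h : ℝ) ^ (-1 - ε) * (X ^ ε *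
        ((∫ τ, |τ| ^ (ε - 1) * Real.exp (-(Real.pi * R ^ 2) * τ ^ 2) *
          (L + 2 * ∑ k ∈ Finset.Ico 1 L, spike L (2 * ((τ - h / R) * A) * k))) +
        ∫ τ, |τ| ^ (ε - 1) * Real.exp (-(Real.pi * R ^ 2) * τ ^ 2) *
          (L + 2 * ∑ k ∈ Finset.Ico 1 L, spike L (2 * ((τ - h / R) * B) * k)))) := by
          refine Finset.sum_le_sum fun h _ => mul_le_mul_of_nonneg_left (h1 h) (by positivity)
      _ ≤ M := by
          have hdist : ∀ a p q : ℕ → ℝ, ∑ h ∈ Finset.Ico 1 H, a h * (X ^ ε * (p h + q h))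
              = X ^ ε * (∑ h ∈ Finset.Ico 1 H, a h * p h + ∑ h ∈ Finset.Ico 1 H, a h * q h) := by
            intro a p q
            rw [← Finset.sum_add_distrib, Finset.mul_sum]
            exact Finset.sum_congr rfl fun h _ => by ring
          refine (hdist _ _ _).trans_le ?_
          rw [hM, add_mul]
          exact mul_le_mul_of_nonneg_left (add_le_add (hWA R L H hR hL) (hWB R L H hR hL))
            (by positivity)
  have hη : 0 < 1 / R := by positivity
  have hη1 : 1 / R ≤ 1 := by rw [div_le_one hR0]; exact hR.le
  -- The shift `-(1 / R)` yields the backward difference quotient used in `sawtooth_le`, the shift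
  -- `0` the forward one of `le_sawtooth`. The error `1 / R` per point totals `O(R)` over the `L ^
  -- 2` points.
  have hup := abs_sum_sawtoothPrimitive_le s w t X (-(1 / R)) hR hε hε1 hfreq
  have hlow := abs_sum_sawtoothPrimitive_le s w t X 0 hR hε hε1 hfreq
  have hcard : ∑ n ∈ s, w n * (1 / R) ≤ C₁ ^ 2 * R := by
    calc ∑ n ∈ s, w n * (1 / R) ≤ ∑ n ∈ s, 1 * (1 / R) := by
          gcongr with n _
          exact hw1 n
      _ = (L : ℝ) ^ 2 / R := by
          rw [Finset.sum_const, hs, Finset.card_product, Finset.card_range, nsmul_eq_mul]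
          push_cast; ring
      _ ≤ (C₁ * R) ^ 2 / R := by gcongr
      _ = _ := by field_simp
  -- The five `ε`: one from the frequency weight, two from `X ^ ε` with `X ≤ c₀ * R ^ 2`, two from
  -- the averaged Weyl bound.
  have hfinal : R ^ ε * M + C₁ ^ 2 * R ≤ (c₀ ^ ε * (CA + CB) + C₁ ^ 2) * R ^ (1 + 5 * ε) := by
    have h1 : X ^ ε ≤ c₀ ^ ε * R ^ (2 * ε) := by
      calc X ^ ε ≤ (c₀ * R ^ 2) ^ ε := by gcongr
        _ = _ := by
          rw [Real.mul_rpow hc₀.le (by positivity), ← Real.rpow_natCast, ← Real.rpow_mul hR0.le]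
          push_cast; rfl
    have h2 : R ≤ R ^ (1 + 5 * ε) := by
      conv_lhs => rw [← Real.rpow_one R]
      exact Real.rpow_le_rpow_of_exponent_le hR.le (by linarith)
    calc R ^ ε * M + C₁ ^ 2 * R
        ≤ R ^ ε * (c₀ ^ ε * R ^ (2 * ε) * ((CA + CB) * R ^ (1 + 2 * ε))) +
          C₁ ^ 2 * R ^ (1 + 5 * ε) := by rw [hM]; gcongr
      _ = c₀ ^ ε * (CA + CB) * (R ^ ε * R ^ (2 * ε) * R ^ (1 + 2 * ε)) +
          C₁ ^ 2 * R ^ (1 + 5 * ε) := by ring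
      _ = _ := by
          rw [← Real.rpow_add hR0, ← Real.rpow_add hR0]
          ring_nf
  rw [abs_le] at hup hlow ⊢
  constructor
  · have h1 : ∑ n ∈ s, w n * ((sawtoothPrimitive ((X - t n) / R + 0 + 1 / R) -
        sawtoothPrimitive ((X - t n) / R + 0)) / (1 / R)) - ∑ n ∈ s, w n * (1 / R)
        ≤ ∑ n ∈ s, w n * sawtooth ((X - t n) / R) := by
      rw [← Finset.sum_sub_distrib]
      refine Finset.sum_le_sum fun n _ => ?_
      rw [← mul_sub, add_zero]
      exact mul_le_mul_of_nonneg_left (le_sawtooth hη hη1) (hw0 n)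
    linarith [hlow.1]
  · have h1 : ∑ n ∈ s, w n * sawtooth ((X - t n) / R) ≤
        ∑ n ∈ s, w n * ((sawtoothPrimitive ((X - t n) / R + -(1 / R) + 1 / R) -
        sawtoothPrimitive ((X - t n) / R + -(1 / R))) / (1 / R)) + ∑ n ∈ s, w n * (1 / R) := by
      rw [← Finset.sum_add_distrib]
      refine Finset.sum_le_sum fun n _ => ?_
      rw [← mul_add, neg_add_cancel_right, ← sub_eq_add_neg]
      exact mul_le_mul_of_nonneg_left (sawtooth_le hη hη1) (hw0 n)
    linarith [hup.2]

/-! ### Positive definite forms: the norm `√Q`, unit cubes, lattice points in shells -/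

section PosDef

variable {ι : Type*} {Q : QuadraticForm ℝ (ι → ℝ)}

lemma associated_self (Q : QuadraticForm ℝ (ι → ℝ)) (x : ι → ℝ) :
    QuadraticMap.associated Q x x = Q x :=
  QuadraticMap.associated_eq_self_apply ℝ Q x

lemma quadraticForm_add (Q : QuadraticForm ℝ (ι → ℝ)) (x y : ι → ℝ) :
    Q (x + y) = Q x + 2 * QuadraticMap.associated Q x y + Q y := by
  have h := QuadraticMap.associated_isSymm ℝ Q x y
  rw [← associated_self, map_add, map_add, LinearMap.add_apply, LinearMap.add_apply,
    associated_self, associated_self, ← h]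
  ring

lemma quadraticForm_sub (Q : QuadraticForm ℝ (ι → ℝ)) (x y : ι → ℝ) :
    Q (x - y) = Q x - 2 * QuadraticMap.associated Q x y + Q y := by
  rw [sub_eq_add_neg, quadraticForm_add, map_neg, QuadraticMap.map_neg]
  ring

/-- Cauchy–Schwarz for the associated bilinear form. -/
lemma sqrt_quadraticForm_add_le (hQ : Q.PosDef) (x y : ι → ℝ) :
    √(Q (x + y)) ≤ √(Q x) + √(Q y) := by
  have hx := hQ.nonneg x
  have hy := hQ.nonneg y
  have hcs := LinearMap.BilinForm.apply_sq_le_of_symm (QuadraticMap.associated Q)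
    (fun x => by rw [associated_self]; exact hQ.nonneg x)
    ⟨fun x y => QuadraticMap.associated_isSymm ℝ Q x y⟩ x y
  rw [associated_self, associated_self] at hcs
  have h1 : QuadraticMap.associated Q x y ≤ √(Q x) * √(Q y) := by
    rw [← Real.sqrt_mul hx]
    exact Real.le_sqrt_of_sq_le hcs
  rw [Real.sqrt_le_left (by positivity), quadraticForm_add, add_sq, Real.sq_sqrt hx,
    Real.sq_sqrt hy]
  linarith

lemma sqrt_quadraticForm_sub_le (hQ : Q.PosDef) (x y : ι → ℝ) :
    √(Q x) - √(Q y) ≤ √(Q (x + y)) := by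
  have h := sqrt_quadraticForm_add_le hQ (x + y) (-y)
  rw [add_neg_cancel_right, QuadraticMap.map_neg] at h
  linarith

/-- The half-open unit cube. -/
def unitCube (ι : Type*) : Set (ι → ℝ) := Set.univ.pi fun _ => Set.Ico 0 1

/-- The translate of the unit cube by an integral vector. -/
def latticeCube (n : ι → ℤ) : Set (ι → ℝ) := (fun z => (fun i => -(n i : ℝ)) + z) ⁻¹' unitCube ι

lemma pairwise_disjoint_latticeCube :
    Pairwise (Function.onFun Disjoint (latticeCube : (ι → ℤ) → Set (ι → ℝ))) := by
  intro n k hnk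
  rw [Function.onFun, Set.disjoint_left]
  intro z hn hk
  apply hnk
  ext i
  have h1 := hn i trivial
  have h2 := hk i trivial
  simp only [Pi.add_apply, Set.mem_Ico] at h1 h2
  have h3 : (n i : ℝ) < k i + 1 := by linarith
  have h4 : (k i : ℝ) < n i + 1 := by linarith
  have h5 : n i < k i + 1 := by exact_mod_cast h3
  have h6 : k i < n i + 1 := by exact_mod_cast h4
  omega

variable [Fintype ι]

lemma continuous_quadraticForm (Q : QuadraticForm ℝ (ι → ℝ)) : Continuous Q := by
  have h : ⇑Q = fun x => LinearMap.toContinuousBilinearMap (QuadraticMap.associated Q) x x := by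
    ext x; exact (associated_self Q x).symm
  rw [h]; fun_prop

lemma exists_quadraticForm_le (Q : QuadraticForm ℝ (ι → ℝ)) :
    ∃ C : ℝ, 0 < C ∧ ∀ x, Q x ≤ C * ‖x‖ ^ 2 := by
  set B := LinearMap.toContinuousBilinearMap (QuadraticMap.associated Q) with hB
  refine ⟨‖B‖ + 1, by positivity, fun x => ?_⟩
  have h1 : Q x = B x x := (associated_self Q x).symm
  have h2 := B.le_opNorm₂ x x
  rw [← h1] at h2
  have h3 := le_abs_self (Q x)
  rw [Real.norm_eq_abs] at h2
  nlinarith [sq_nonneg ‖x‖]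

lemma exists_le_quadraticForm (hQ : Q.PosDef) :
    ∃ c : ℝ, 0 < c ∧ ∀ x, c * ‖x‖ ^ 2 ≤ Q x := by
  -- The sphere is empty only in the zero space; otherwise `Q` attains a positive minimum on it, and
  -- homogeneity does the rest.
  rcases (Metric.sphere (0 : ι → ℝ) 1).eq_empty_or_nonempty with h | h
  · refine ⟨1, one_pos, fun x => ?_⟩
    by_cases hx : x = 0
    · simp [hx]
    · have : ‖x‖⁻¹ • x ∈ Metric.sphere (0 : ι → ℝ) 1 := by
        rw [mem_sphere_zero_iff_norm, norm_smul, norm_inv, norm_norm,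
          inv_mul_cancel₀ (norm_ne_zero_iff.mpr hx)]
      rw [h] at this
      exact this.elim
  · obtain ⟨y, hy, hmin⟩ := (isCompact_sphere (0 : ι → ℝ) 1).exists_isMinOn h
      (continuous_quadraticForm Q).continuousOn
    have hy0 : y ≠ 0 := by
      rintro rfl
      simp at hy
    refine ⟨Q y, hQ y hy0, fun x => ?_⟩
    by_cases hx : x = 0
    · simp [hx]
    · have hx' := norm_ne_zero_iff.mpr hx
      have hmem : ‖x‖⁻¹ • x ∈ Metric.sphere (0 : ι → ℝ) 1 := by
        rw [mem_sphere_zero_iff_norm, norm_smul, norm_inv, norm_norm, inv_mul_cancel₀ hx']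
      have h2 := hmin hmem
      simp only [Set.mem_ofPred_eq, QuadraticMap.map_smul, smul_eq_mul] at h2
      calc Q y * ‖x‖ ^ 2 ≤ ‖x‖⁻¹ * ‖x‖⁻¹ * Q x * ‖x‖ ^ 2 := by gcongr
        _ = Q x := by field_simp

lemma exists_sqrt_quadraticForm_le (Q : QuadraticForm ℝ (ι → ℝ)) :
    ∃ K : ℝ, 0 < K ∧ ∀ u : ι → ℝ, ‖u‖ ≤ 1 → √(Q u) ≤ K := by
  obtain ⟨C, hC, h⟩ := exists_quadraticForm_le Q
  refine ⟨√C, by positivity, fun u hu => Real.sqrt_le_sqrt ((h u).trans ?_)⟩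
  have : ‖u‖ ^ 2 ≤ 1 := pow_le_one₀ (norm_nonneg u) hu
  nlinarith

lemma finite_setOf_quadraticForm_le (hQ : Q.PosDef) (α : ι → ℝ) (X : ℝ) :
    {n : ι → ℤ | Q ((fun i => (n i : ℝ)) + α) ≤ X}.Finite := by
  obtain ⟨c, hc, h⟩ := exists_le_quadraticForm hQ
  set M := √(X / c) with hM
  refine (Set.Finite.pi fun i => Set.finite_Icc (⌈-M - α i⌉) (⌊M - α i⌋)).subset fun n hn i _ => ?_
  have h1 : ‖(fun i => (n i : ℝ)) + α‖ ≤ M := by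
    apply Real.le_sqrt_of_sq_le
    rw [le_div_iff₀ hc, mul_comm]
    exact (h _).trans hn
  have h2 := (norm_le_pi_norm ((fun i => (n i : ℝ)) + α) i).trans h1
  rw [Real.norm_eq_abs, abs_le, Pi.add_apply] at h2
  rw [Set.mem_Icc, Int.ceil_le, Int.le_floor]
  constructor <;> linarith [h2.1, h2.2]

lemma measurableSet_unitCube : MeasurableSet (unitCube ι) :=
  MeasurableSet.univ_pi fun _ => measurableSet_Ico

lemma volume_unitCube : volume (unitCube ι) = 1 := by
  have := Real.volume_pi_Ico (ι := ι) (a := 0) (b := 1)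
  simpa [unitCube] using this

lemma norm_le_one_of_mem_unitCube {u : ι → ℝ} (hu : u ∈ unitCube ι) : ‖u‖ ≤ 1 := by
  rw [pi_norm_le_iff_of_nonneg zero_le_one]
  intro i
  have := hu i trivial
  rw [Real.norm_eq_abs, abs_le]
  constructor <;> linarith [this.1, this.2]

lemma measurableSet_latticeCube (n : ι → ℤ) : MeasurableSet (latticeCube n) :=
  measurableSet_unitCube.preimage (measurable_const_add _)

lemma volume_latticeCube (n : ι → ℤ) : volume (latticeCube n) = 1 := by
  rw [latticeCube, measure_preimage_add, volume_unitCube]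

/-- The unit cubes at distinct integral points are disjoint and have volume `1`. -/
lemma card_le_volume (S : Finset (ι → ℤ)) (T : Set (ι → ℝ))
    (h : ∀ n ∈ S, ∀ u ∈ unitCube ι, (fun i => (n i : ℝ)) + u ∈ T) : (S.card : ENNReal) ≤ volume T := by
  have h1 : volume (⋃ n ∈ S, latticeCube n) = S.card := by
    rw [measure_biUnion_finset (fun n _ k _ hnk => pairwise_disjoint_latticeCube hnk)
      fun n _ => measurableSet_latticeCube n]
    simp [volume_latticeCube]
  rw [← h1]
  refine measure_mono (Set.iUnion₂_subset fun n hn z hz => ?_)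
  have := h n hn _ hz
  convert this using 1
  ext i; simp

/-- Unfolding the integral over the space to the unit cube. -/
lemma integral_eq_sum_unitCube {f : (ι → ℝ) → ℝ} (hf : Integrable f) (S : Finset (ι → ℤ))
    (h : ∀ n ∉ S, ∀ u ∈ unitCube ι, f ((fun i => (n i : ℝ)) + u) = 0) :
    ∫ z, f z = ∑ n ∈ S, ∫ u in unitCube ι, f ((fun i => (n i : ℝ)) + u) := by
  rw [← setIntegral_eq_integral_of_forall_compl_eq_zero (s := ⋃ n ∈ S, latticeCube n),
    integral_biUnion_finset S (fun n _ => measurableSet_latticeCube n)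
      (fun n _ k _ hnk => pairwise_disjoint_latticeCube hnk) fun n _ => hf.integrableOn]
  · refine Finset.sum_congr rfl fun n _ => ?_
    rw [← integral_indicator (measurableSet_latticeCube n),
      ← integral_indicator measurableSet_unitCube,
      ← integral_add_left_eq_self _ (fun i => (n i : ℝ))]
    congr 1
    ext u
    have : (fun i => (n i : ℝ)) + u ∈ latticeCube n ↔ u ∈ unitCube ι := by
      rw [latticeCube, Set.mem_preimage]
      have : (fun i => -(n i : ℝ)) + ((fun i => (n i : ℝ)) + u) = u := by ext i; simp
      rw [this]
    by_cases hu : u ∈ unitCube ι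
    · rw [Set.indicator_of_mem hu, Set.indicator_of_mem (this.mpr hu)]
    · rw [Set.indicator_of_notMem hu, Set.indicator_of_notMem (this.not.mpr hu)]
  · intro z hz
    set n : ι → ℤ := fun i => ⌊z i⌋ with hn
    have h1 : z = (fun i => (n i : ℝ)) + fun i => Int.fract (z i) := by
      ext i; simp [hn]
    have h2 : (fun i => Int.fract (z i)) ∈ unitCube ι := fun i _ =>
      ⟨Int.fract_nonneg _, Int.fract_lt_one _⟩
    rw [h1]
    refine h n (fun hnS => hz ?_) _ h2
    rw [Set.mem_iUnion₂]
    refine ⟨n, hnS, ?_⟩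
    rw [latticeCube, Set.mem_preimage]
    convert h2 using 1
    ext i
    simp only [Pi.add_apply, hn, ← Int.self_sub_floor]
    ring

open Pointwise in
lemma volume_setOf_sqrt_le (Q : QuadraticForm ℝ (ι → ℝ)) (hQ : Q.PosDef) {r : ℝ} (hr : 0 ≤ r) :
    volume.real {z | √(Q z) ≤ r} = r ^ Fintype.card ι * volume.real {z | √(Q z) ≤ 1} := by
  have h1 : {z | √(Q z) ≤ r} = r • {z | √(Q z) ≤ 1} := by
    ext z
    rw [Set.mem_smul_set, Set.mem_ofPred_eq]
    constructor
    · intro hz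
      rcases hr.eq_or_lt with rfl | hr0
      · have h2 : Q z ≤ 0 := by
          have := (Real.sqrt_eq_zero (hQ.nonneg z)).mp (le_antisymm hz (Real.sqrt_nonneg _))
          exact this.le
        exact ⟨0, by simp, by rw [smul_zero, hQ.le_zero_iff.mp h2]⟩
      · refine ⟨r⁻¹ • z, ?_, smul_inv_smul₀ hr0.ne' z⟩
        rw [Set.mem_ofPred_eq, QuadraticMap.map_smul, smul_eq_mul,
          Real.sqrt_mul (mul_self_nonneg _), Real.sqrt_mul_self (by positivity),
          inv_mul_le_one₀ hr0]
        exact hz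
    · rintro ⟨w, hw, rfl⟩
      rw [QuadraticMap.map_smul, smul_eq_mul, Real.sqrt_mul (mul_self_nonneg _),
        Real.sqrt_mul_self hr]
      exact mul_le_of_le_one_right hr hw
  rw [h1, measureReal_def, Measure.addHaar_smul, ENNReal.toReal_mul,
    Module.finrank_fintype_fun_eq_card, abs_of_nonneg (by positivity),
    ENNReal.toReal_ofReal (by positivity), measureReal_def]

lemma isBounded_setOf_sqrt_le (hQ : Q.PosDef) (r : ℝ) :
    Bornology.IsBounded {z | √(Q z) ≤ r} := by
  obtain ⟨c, hc, h⟩ := exists_le_quadraticForm hQ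
  refine (Metric.isBounded_closedBall (x := (0 : ι → ℝ)) (r := √(r ^ 2 / c))).subset fun z hz => ?_
  rw [mem_closedBall_zero_iff]
  apply Real.le_sqrt_of_sq_le
  rw [le_div_iff₀ hc, mul_comm]
  refine (h z).trans ?_
  rw [← Real.sq_sqrt (hQ.nonneg z)]
  exact pow_le_pow_left₀ (Real.sqrt_nonneg _) hz 2

lemma measurableSet_setOf_sqrt_le (Q : QuadraticForm ℝ (ι → ℝ)) (r : ℝ) :
    MeasurableSet {z | √(Q z) ≤ r} :=
  (isClosed_le (continuous_quadraticForm Q).sqrt continuous_const).measurableSet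

/-- Lattice points in a shell. -/
lemma card_shell_le (hQ : Q.PosDef) {k : ℕ} (hk : Fintype.card ι = k + 1) :
    ∃ K : ℝ, 0 < K ∧ ∀ (S : Finset (ι → ℤ)) (α : ι → ℝ) (a b : ℝ), a ≤ b → 0 ≤ b →
      (∀ n ∈ S, a ≤ √(Q ((fun i => (n i : ℝ)) + α)) ∧ √(Q ((fun i => (n i : ℝ)) + α)) ≤ b) →
      (S.card : ℝ) ≤ K * (b + K) ^ k * (b - a + K) := by
  obtain ⟨K₀, hK₀, hcube⟩ := exists_sqrt_quadraticForm_le Q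
  set κ := volume.real {z | √(Q z) ≤ 1} with hκ
  have hκ0 : 0 ≤ κ := measureReal_nonneg
  set K := max (2 * K₀ + 1) (κ * (k + 1)) with hK
  have hK1 : 2 * K₀ + 1 ≤ K := le_max_left _ _
  have hK2 : κ * (k + 1) ≤ K := le_max_right _ _
  refine ⟨K, by linarith, fun S α a b hab hb hS => ?_⟩
  have hfin : ∀ r, volume {z | √(Q z) ≤ r} ≠ ⊤ := fun r =>
    (isBounded_setOf_sqrt_le hQ r).measure_lt_top.ne
  have hnear : ∀ n ∈ S, ∀ u ∈ unitCube ι, a - K₀ ≤ √(Q ((fun i => (n i : ℝ)) + u + α)) ∧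
      √(Q ((fun i => (n i : ℝ)) + u + α)) ≤ b + K₀ := by
    intro n hn u hu
    have h1 := hcube u (norm_le_one_of_mem_unitCube hu)
    have h2 := sqrt_quadraticForm_add_le hQ ((fun i => (n i : ℝ)) + α) u
    have h3 := sqrt_quadraticForm_sub_le hQ ((fun i => (n i : ℝ)) + α) u
    have h4 := hS n hn
    rw [add_right_comm] at h2 h3
    constructor <;> linarith [h4.1, h4.2]
  -- The unit cubes at points of `S` lie where `√Q` is between `a - K₀` and `b + K₀`. The additional
  -- `1` keeps them off the closed ball of radius `a'`. If `a' < 0` no ball is removed.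
  set a' := a - K₀ - 1 with ha'
  set b' := b + K₀ with hb'
  have hb0 : 0 ≤ b' := by linarith
  have key : (S.card : ℝ) ≤ κ * ((k + 1) * b' ^ k * (b' - a')) := by
    rcases lt_or_ge a' 0 with ha0 | ha0
    · have h1 := card_le_volume S ((fun z => z + α) ⁻¹' {z | √(Q z) ≤ b'})
        fun n hn u hu => (hnear n hn u hu).2
      rw [measure_preimage_add_right] at h1
      have h2 : (S.card : ℝ) ≤ volume.real {z | √(Q z) ≤ b'} := by
        have := ENNReal.toReal_mono (hfin b') h1
        simpa [measureReal_def] using this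
      rw [volume_setOf_sqrt_le Q hQ hb0, hk, ← hκ] at h2
      have h3 : b' ^ (k + 1) ≤ (k + 1) * b' ^ k * (b' - a') := by
        have h5 : 0 ≤ b' ^ k := by positivity
        have h6 : (0 : ℝ) ≤ k := by positivity
        calc b' ^ (k + 1) = 1 * b' ^ k * b' := by ring
          _ ≤ _ := by gcongr <;> linarith
      nlinarith
    · have h1 := card_le_volume S
        ((fun z => z + α) ⁻¹' ({z | √(Q z) ≤ b'} \ {z | √(Q z) ≤ a'}))
        fun n hn u hu => ⟨(hnear n hn u hu).2, fun h => by
          have h2 := (hnear n hn u hu).1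
          have h3 : √(Q ((fun i => (n i : ℝ)) + u + α)) ≤ a' := h
          linarith⟩
      rw [measure_preimage_add_right] at h1
      have hsub : {z | √(Q z) ≤ a'} ⊆ {z | √(Q z) ≤ b'} := fun z hz =>
        le_trans (show √(Q z) ≤ a' from hz) (by linarith)
      have h2 : (S.card : ℝ) ≤ volume.real ({z | √(Q z) ≤ b'} \ {z | √(Q z) ≤ a'}) := by
        have := ENNReal.toReal_mono
          (measure_ne_top_of_subset Set.sdiff_subset (hfin b')) h1
        simpa [measureReal_def] using this
      rw [measureReal_sdiff hsub (measurableSet_setOf_sqrt_le Q a') (hfin b'),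
        volume_setOf_sqrt_le Q hQ hb0, volume_setOf_sqrt_le Q hQ ha0, hk, ← hκ] at h2
      have h3 := (le_abs_self _).trans (abs_pow_sub_pow_le b' a' (k + 1))
      have hba : a' ≤ b' := by linarith
      rw [abs_of_nonneg (by linarith), abs_of_nonneg hb0, abs_of_nonneg ha0, max_eq_left hba,
        Nat.add_sub_cancel] at h3
      push_cast at h3
      calc (S.card : ℝ) ≤ κ * (b' ^ (k + 1) - a' ^ (k + 1)) := by linarith
        _ ≤ κ * ((b' - a') * (k + 1) * b' ^ k) := by gcongr
        _ = _ := by ring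
  have h0 : 0 ≤ b' - a' := by linarith
  calc (S.card : ℝ) ≤ κ * (k + 1) * b' ^ k * (b' - a') := by linarith
    _ ≤ K * (b + K) ^ k * (b - a + K) := by
        gcongr <;> linarith

end PosDef

/-! ### The Riesz mean of a positive definite form -/

section RieszMean

variable {ι : Type*} {Q : QuadraticForm ℝ (ι → ℝ)}

lemma abs_max_sub_max_le (X a b : ℝ) : |max 0 (X - a) - max 0 (X - b)| ≤ |a - b| := by
  have h := abs_max_sub_max_le_max 0 (X - a) 0 (X - b)
  rw [sub_self, abs_zero, sub_sub_sub_cancel_left, max_eq_right (abs_nonneg (b - a)),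
    abs_sub_comm b] at h
  exact h

/-- The second difference of the truncated quadratic polynomial. -/
lemma abs_second_difference_le (hQ : Q.PosDef) {X K₀ : ℝ} (hX : 0 ≤ X) {z u : ι → ℝ}
    (hu : √(Q u) ≤ K₀) :
    |(max 0 (X - Q (z + u)) + max 0 (X - Q (z - u))) / 2 - max 0 (X - Q z)| ≤
      K₀ ^ 2 + if |√(Q z) - √X| ≤ K₀ then K₀ * (2 * √X + 3 * K₀) else 0 := by
  have hK₀ : 0 ≤ K₀ := (Real.sqrt_nonneg _).trans hu
  have hr := Real.sqrt_nonneg X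
  have hr2 := Real.sq_sqrt hX
  have hsq := fun w => Real.sq_sqrt (hQ.nonneg w)
  have hneg : √(Q (-u)) = √(Q u) := by rw [QuadraticMap.map_neg]
  have h1 := sqrt_quadraticForm_add_le hQ z u
  have h2 := sqrt_quadraticForm_sub_le hQ z u
  have h3 := sqrt_quadraticForm_add_le hQ z (-u)
  have h4 := sqrt_quadraticForm_sub_le hQ z (-u)
  rw [hneg, ← sub_eq_add_neg] at h3 h4
  have n1 := Real.sqrt_nonneg (Q (z + u))
  have n2 := Real.sqrt_nonneg (Q (z - u))
  have n3 := Real.sqrt_nonneg (Q z)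
  have n4 := Real.sqrt_nonneg (Q u)
  split_ifs with hcase
  · obtain ⟨h5, h6⟩ := abs_le.mp hcase
    have key : ∀ w : ι → ℝ, √(Q w) ≤ √(Q z) + √(Q u) → √(Q z) - √(Q u) ≤ √(Q w) →
        |max 0 (X - Q w) - max 0 (X - Q z)| ≤ K₀ * (2 * √X + 3 * K₀) := by
      intro w hw1 hw2
      refine (abs_max_sub_max_le X (Q w) (Q z)).trans ?_
      have n5 := Real.sqrt_nonneg (Q w)
      rw [← hsq w, ← hsq z, sq_sub_sq, abs_mul, mul_comm,
        abs_of_nonneg (add_nonneg n5 n3)]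
      have h7 : |√(Q w) - √(Q z)| ≤ K₀ := abs_le.mpr ⟨by linarith, by linarith⟩
      have h8 : √(Q w) + √(Q z) ≤ 2 * √X + 3 * K₀ := by linarith
      exact mul_le_mul h7 h8 (by positivity) hK₀
    have k1 := abs_le.mp (key (z + u) h1 h2)
    have k2 := abs_le.mp (key (z - u) h3 h4)
    rw [abs_le]
    constructor <;> nlinarith [k1.1, k1.2, k2.1, k2.2]
  -- Away from the boundary the points `z` and `z ± u` lie on the same side. Inside, the half second
  -- difference is exactly `-Q u`; outside, all three values vanish.
  · rw [abs_le, not_and_or, not_le, not_le] at hcase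
    rcases hcase with h | h
    · have b1 : Q (z + u) ≤ X := (Real.sqrt_le_sqrt_iff hX).mp (by linarith)
      have b2 : Q (z - u) ≤ X := (Real.sqrt_le_sqrt_iff hX).mp (by linarith)
      have b3 : Q z ≤ X := (Real.sqrt_le_sqrt_iff hX).mp (by linarith)
      rw [max_eq_right (by linarith), max_eq_right (by linarith), max_eq_right (by linarith),
        quadraticForm_add, quadraticForm_sub, add_zero]
      have h5 : Q u ≤ K₀ ^ 2 := by rw [← hsq]; gcongr
      have h6 := hQ.nonneg u
      rw [abs_le]
      constructor <;> linarith
    · have b1 : X ≤ Q (z + u) := (Real.sqrt_le_sqrt_iff (hQ.nonneg _)).mp (by linarith)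
      have b2 : X ≤ Q (z - u) := (Real.sqrt_le_sqrt_iff (hQ.nonneg _)).mp (by linarith)
      have b3 : X ≤ Q z := (Real.sqrt_le_sqrt_iff (hQ.nonneg _)).mp (by linarith)
      rw [max_eq_left (by linarith), max_eq_left (by linarith), max_eq_left (by linarith)]
      simp
      positivity

variable [Fintype ι]

lemma integrable_max_sub_quadraticForm (hQ : Q.PosDef) (X : ℝ) (α : ι → ℝ) :
    Integrable fun z : ι → ℝ => max 0 (X - Q (z + α)) := by
  have hc := continuous_quadraticForm Q
  have h : Integrable fun z : ι → ℝ => max 0 (X - Q z) := by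
    refine Continuous.integrable_of_hasCompactSupport (by fun_prop)
      (HasCompactSupport.intro (K := {z | √(Q z) ≤ √X})
        (Metric.isCompact_of_isClosed_isBounded (isClosed_le hc.sqrt continuous_const)
          (isBounded_setOf_sqrt_le hQ _)) fun z hz => ?_)
    rw [Set.mem_ofPred_eq, not_le] at hz
    have : X < Q z := lt_of_not_ge fun h => hz.not_ge (Real.sqrt_le_sqrt h)
    exact max_eq_left (by linarith)
  exact h.comp_add_right α

/-- The second differences are `O(1)` at `O(R ^ (k + 1))` points and `O(R)` at the `O(R ^ k)` points
of the boundary shell; both contributions have the order claimed. -/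
lemma riesz_mean_le (hQ : Q.PosDef) {k : ℕ} (hk : Fintype.card ι = k + 1) (c₀ : ℝ) (hc₀ : 0 < c₀) :
    ∃ C : ℝ, 0 ≤ C ∧ ∀ (R X : ℝ) (α : ι → ℝ) (S : Finset (ι → ℤ)), 1 < R → 0 ≤ X →
      X ≤ c₀ * R ^ 2 → (∀ n, n ∈ S ↔ Q ((fun i => (n i : ℝ)) + α) ≤ X) →
      |∑ n ∈ S, (X - Q ((fun i => (n i : ℝ)) + α)) - ∫ z, max 0 (X - Q (z + α))|
        ≤ C * R ^ (k + 1) := by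
  obtain ⟨K₀, hK₀, hcube⟩ := exists_sqrt_quadraticForm_le Q
  obtain ⟨K, hK, hshell⟩ := card_shell_le hQ hk
  set D := √c₀ + K₀ + K with hD
  have hD0 : 0 < D := by positivity
  refine ⟨K₀ ^ 2 * (K * D ^ k * D) + K₀ * (2 * √c₀ + 3 * K₀) * (K * D ^ k * (2 * K₀ + K)),
    by positivity, fun R X α S hR hX hXR hS => ?_⟩
  have hR0 : 0 < R := by linarith
  have hrR : √X ≤ √c₀ * R := by
    rw [Real.sqrt_le_left (by positivity), mul_pow, Real.sq_sqrt hc₀.le]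
    exact hXR
  have hr0 := Real.sqrt_nonneg X
  set f : (ι → ℝ) → ℝ := fun z => max 0 (X - Q (z + α)) with hf
  have hfi : Integrable f := integrable_max_sub_quadraticForm hQ X α
  -- The margin `K₀` makes `S'` contain every lattice point whose cube, or reflected cube, meets the
  -- support of `f`.
  set S' := (finite_setOf_quadraticForm_le hQ α ((√X + K₀) ^ 2)).toFinset with hS'
  have hmem : ∀ n : ι → ℤ, n ∈ S' ↔ √(Q ((fun i => (n i : ℝ)) + α)) ≤ √X + K₀ := by
    intro n
    rw [hS', Set.Finite.mem_toFinset, Set.mem_ofPred_eq, Real.sqrt_le_left (by positivity)]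
  have hzero : ∀ n ∉ S', ∀ u : ι → ℝ, ‖u‖ ≤ 1 → f ((fun i => (n i : ℝ)) + u) = 0 := by
    intro n hn u hu
    rw [hmem, not_le] at hn
    have h1 := sqrt_quadraticForm_sub_le hQ ((fun i => (n i : ℝ)) + α) u
    have h2 := hcube u hu
    rw [add_right_comm] at h1
    have h3 : √X < √(Q ((fun i => (n i : ℝ)) + u + α)) := by linarith
    have h4 := lt_of_not_ge fun h => h3.not_ge (Real.sqrt_le_sqrt h)
    exact max_eq_left (by linarith)
  have hsum : ∑ n ∈ S, (X - Q ((fun i => (n i : ℝ)) + α)) = ∑ n ∈ S', f (fun i => (n i : ℝ)) := by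
    have hsub : S ⊆ S' := by
      intro n hn
      rw [hmem]
      have := Real.sqrt_le_sqrt ((hS n).mp hn)
      linarith
    rw [← Finset.sum_subset hsub fun n _ hn => ?_]
    · refine Finset.sum_congr rfl fun n hn => ?_
      have := (hS n).mp hn
      exact (max_eq_right (by linarith)).symm
    · have := (hS n).not.mp hn
      exact max_eq_left (by linarith)
  have hint1 : ∫ z, f z = ∑ n ∈ S', ∫ u in unitCube ι, f ((fun i => (n i : ℝ)) + u) :=
    integral_eq_sum_unitCube hfi S' fun n hn u hu =>
      hzero n hn u (norm_le_one_of_mem_unitCube hu)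
  have hcast : ∀ (n : ι → ℤ) (u : ι → ℝ),
      -((fun i => ((-n) i : ℝ)) + u) = (fun i => (n i : ℝ)) - u := by
    intro n u
    ext i
    simp only [Pi.neg_apply, Pi.add_apply, Pi.sub_apply, Int.cast_neg]
    ring
  -- The tiling by reflected cubes. Averaging it with the first tiling cancels the terms linear in
  -- `u`.
  have hint2 : ∫ z, f z = ∑ n ∈ S', ∫ u in unitCube ι, f ((fun i => (n i : ℝ)) - u) := by
    classical
    rw [← integral_neg_eq_self f, integral_eq_sum_unitCube hfi.comp_neg (S'.image Neg.neg)]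
    · rw [Finset.sum_image fun a _ b _ h => neg_injective h]
      refine Finset.sum_congr rfl fun n _ => ?_
      simp_rw [← hcast n]
    · intro n hn u hu
      have hn' : -n ∉ S' := fun h => hn (Finset.mem_image.mpr ⟨-n, h, neg_neg n⟩)
      have h1 := hzero (-n) hn' (-u) (by rw [norm_neg]; exact norm_le_one_of_mem_unitCube hu)
      convert h1 using 2
      ext i
      simp only [Pi.neg_apply, Pi.add_apply, Int.cast_neg]
      ring
  have hon1 : ∀ n : ι → ℤ, IntegrableOn (fun u => f ((fun i => (n i : ℝ)) + u)) (unitCube ι) :=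
    fun n => (hfi.comp_add_left _).integrableOn
  have hon2 : ∀ n : ι → ℤ, IntegrableOn (fun u => f ((fun i => (n i : ℝ)) - u)) (unitCube ι) :=
    fun n => (hfi.comp_sub_left _).integrableOn
  have hvol : volume.real (unitCube ι) = 1 := by simp [measureReal_def, volume_unitCube]
  have hdiff : (∫ z, f z) - ∑ n ∈ S', f (fun i => (n i : ℝ)) = ∑ n ∈ S', ∫ u in unitCube ι,
      ((f ((fun i => (n i : ℝ)) + u) + f ((fun i => (n i : ℝ)) - u)) / 2 -
        f (fun i => (n i : ℝ))) := by
    have hpart : ∀ n : ι → ℤ, ∫ u in unitCube ι,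
        ((f ((fun i => (n i : ℝ)) + u) + f ((fun i => (n i : ℝ)) - u)) / 2 -
          f (fun i => (n i : ℝ))) =
        ((∫ u in unitCube ι, f ((fun i => (n i : ℝ)) + u)) +
          ∫ u in unitCube ι, f ((fun i => (n i : ℝ)) - u)) / 2 - f (fun i => (n i : ℝ)) := by
      intro n
      have hadd : IntegrableOn (fun u => f ((fun i => (n i : ℝ)) + u) +
        f ((fun i => (n i : ℝ)) - u)) (unitCube ι) := (hon1 n).add (hon2 n)
      rw [integral_sub (hadd.div_const 2)
        (integrableOn_const (by rw [volume_unitCube]; exact ENNReal.one_ne_top)),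
        integral_div, integral_add (hon1 n) (hon2 n), setIntegral_const, hvol, one_smul]
    simp_rw [hpart]
    rw [Finset.sum_sub_distrib, ← Finset.sum_div, Finset.sum_add_distrib, ← hint1, ← hint2]
    ring
  set W : (ι → ℤ) → ℝ := fun n => K₀ ^ 2 +
    if |√(Q ((fun i => (n i : ℝ)) + α)) - √X| ≤ K₀ then K₀ * (2 * √X + 3 * K₀) else 0 with hW
  have hterm : ∀ n : ι → ℤ, |∫ u in unitCube ι,
      ((f ((fun i => (n i : ℝ)) + u) + f ((fun i => (n i : ℝ)) - u)) / 2 -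
        f (fun i => (n i : ℝ)))| ≤ W n := by
    intro n
    have := norm_setIntegral_le_of_norm_le_const (μ := volume) (s := unitCube ι) (C := W n)
      (f := fun u => (f ((fun i => (n i : ℝ)) + u) + f ((fun i => (n i : ℝ)) - u)) / 2 -
        f (fun i => (n i : ℝ))) (by rw [volume_unitCube]; exact ENNReal.one_lt_top) fun u hu => by
          have h1 := abs_second_difference_le hQ hX (z := (fun i => (n i : ℝ)) + α)
            (hcube u (norm_le_one_of_mem_unitCube hu))
          rwa [add_right_comm, ← sub_add_eq_add_sub] at h1
    rwa [hvol, mul_one, Real.norm_eq_abs] at this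
  have hbound : √X + K₀ + K ≤ D * R := by
    have : K₀ + K ≤ (K₀ + K) * R := le_mul_of_one_le_right (by positivity) hR.le
    rw [hD]; nlinarith
  have hcard1 : (S'.card : ℝ) ≤ K * D ^ k * D * R ^ (k + 1) := by
    have h1 := hshell S' α 0 (√X + K₀) (by positivity) (by positivity) fun n hn =>
      ⟨Real.sqrt_nonneg _, (hmem n).mp hn⟩
    calc (S'.card : ℝ) ≤ K * (√X + K₀ + K) ^ k * (√X + K₀ - 0 + K) := h1
      _ ≤ K * (D * R) ^ k * (D * R) := by
          rw [sub_zero]; gcongr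
      _ = _ := by ring_nf
  have hcard2 : ((S'.filter fun n => |√(Q ((fun i => (n i : ℝ)) + α)) - √X| ≤ K₀).card : ℝ)
      ≤ K * D ^ k * (2 * K₀ + K) * R ^ k := by
    have h1 := hshell (S'.filter fun n => |√(Q ((fun i => (n i : ℝ)) + α)) - √X| ≤ K₀) α
      (√X - K₀) (√X + K₀) (by linarith) (by positivity) fun n hn => by
        have h2 := abs_le.mp (Finset.mem_filter.mp hn).2
        constructor <;> linarith
    calc _ ≤ K * (√X + K₀ + K) ^ k * (√X + K₀ - (√X - K₀) + K) := h1
      _ ≤ K * (D * R) ^ k * (2 * K₀ + K) := by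
          rw [show √X + K₀ - (√X - K₀) = 2 * K₀ by ring]
          gcongr
      _ = _ := by ring_nf
  have hlin : 2 * √X + 3 * K₀ ≤ (2 * √c₀ + 3 * K₀) * R := by nlinarith
  rw [hsum, abs_sub_comm, hdiff]
  calc _ ≤ ∑ n ∈ S', W n := (Finset.abs_sum_le_sum_abs _ _).trans (Finset.sum_le_sum fun n _ => hterm n)
    _ = K₀ ^ 2 * S'.card + K₀ * (2 * √X + 3 * K₀) *
        (S'.filter fun n => |√(Q ((fun i => (n i : ℝ)) + α)) - √X| ≤ K₀).card := by
        rw [Finset.sum_add_distrib, ← Finset.sum_filter, Finset.sum_const, Finset.sum_const,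
          nsmul_eq_mul, nsmul_eq_mul]
        ring
    _ ≤ K₀ ^ 2 * (K * D ^ k * D * R ^ (k + 1)) + K₀ * ((2 * √c₀ + 3 * K₀) * R) *
        (K * D ^ k * (2 * K₀ + K) * R ^ k) :=
        add_le_add (mul_le_mul_of_nonneg_left hcard1 (by positivity))
          (mul_le_mul (mul_le_mul_of_nonneg_left hlin hK₀.le) hcard2 (by positivity)
            (by positivity))
    _ = _ := by ring

end RieszMean

/-! ### Back to the sharp cutoff for binary diagonal forms -/

lemma posDef_weightedSumSquares {A B : ℝ} (hA : 0 < A) (hB : 0 < B) :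
    (QuadraticMap.weightedSumSquares ℝ ![A, B]).PosDef := by
  intro x hx
  rw [QuadraticMap.weightedSumSquares_apply, Fin.sum_univ_two]
  simp only [Matrix.cons_val_zero, Matrix.cons_val_one, smul_eq_mul]
  by_cases h0 : x 0 = 0
  · have h1 : x 1 ≠ 0 := fun h1 => hx (by ext i; fin_cases i <;> simp [h0, h1])
    have := mul_self_pos.mpr h1
    rw [h0]; nlinarith
  · have := mul_self_pos.mpr h0
    nlinarith [mul_self_nonneg (x 1)]

/-- The annulus `Y ≤ t ≤ Y + R` has area `O(R)`, and its boundary has length `O(R)` because of the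
bound `T * R ^ 2`. -/
lemma card_diagForm_shell_le (A B T : ℝ) (hA : 0 < A) (hB : 0 < B) (hT : 0 < T) :
    ∃ K : ℝ, 0 ≤ K ∧ ∀ (R Y γ δ : ℝ) (S : Finset (ℕ × ℕ)), 1 < R →
      (∀ n ∈ S, diagForm A B γ δ n ≤ T * R ^ 2) →
      (∀ n ∈ S, Y ≤ diagForm A B γ δ n ∧ diagForm A B γ δ n ≤ Y + R) →
      (S.card : ℝ) ≤ K * R := by
  obtain ⟨K, hK, hshell⟩ := card_shell_le (posDef_weightedSumSquares hA hB) (k := 1) (by simp)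
  refine ⟨K * (1 + K * 2 * √(T + 1) + K ^ 2), by positivity, fun R Y γ δ S hR hST hS => ?_⟩
  have hR0 : 0 < R := by linarith
  rcases S.eq_empty_or_nonempty with rfl | ⟨n₀, hn₀⟩
  · simp; positivity
  have hdiag0 : ∀ n, 0 ≤ diagForm A B γ δ n := fun n => by unfold diagForm; positivity
  have hYR : 0 ≤ Y + R := (hdiag0 n₀).trans (hS n₀ hn₀).2
  have hYT : Y ≤ T * R ^ 2 := (hS n₀ hn₀).1.trans (hST n₀ hn₀)
  set e : ℕ × ℕ → (Fin 2 → ℤ) := fun n => ![(n.1 : ℤ), (n.2 : ℤ)] with he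
  have hinj : Function.Injective e := by
    intro n k h
    have h0 := congrFun h 0
    have h1 := congrFun h 1
    simp [he] at h0 h1
    exact Prod.ext h0 h1
  have hval : ∀ n, QuadraticMap.weightedSumSquares ℝ ![A, B]
      ((fun i => ((e n) i : ℝ)) + ![γ, δ]) = diagForm A B γ δ n := by
    intro n
    rw [QuadraticMap.weightedSumSquares_apply, Fin.sum_univ_two, diagForm]
    simp [he]
    ring
  classical
  set a := √Y with ha
  set b := √(Y + R) with hb
  have hab : a ≤ b := Real.sqrt_le_sqrt (by linarith)
  have ha0 : 0 ≤ a := Real.sqrt_nonneg _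
  have hb0 : 0 ≤ b := Real.sqrt_nonneg _
  have h1 := hshell (S.image e) ![γ, δ] a b hab hb0 fun n hn => by
    obtain ⟨k, hk, rfl⟩ := Finset.mem_image.mp hn
    rw [hval]
    exact ⟨Real.sqrt_le_sqrt (hS k hk).1, Real.sqrt_le_sqrt (hS k hk).2⟩
  rw [Finset.card_image_of_injective _ hinj, pow_one] at h1
  -- This is `b * (b - a) ≤ b ^ 2 - a ^ 2 ≤ R`; when `Y < 0` the root `a` is `0`, and `Y ≤ a ^ 2`
  -- still holds.
  have h2 : b * (b - a) ≤ R := by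
    have hb2 : b ^ 2 = Y + R := Real.sq_sqrt hYR
    have ha2 : Y ≤ a ^ 2 := by
      rcases le_or_gt 0 Y with h | h
      · exact (Real.sq_sqrt h).ge
      · nlinarith
    nlinarith
  have h3 : b ≤ √(T + 1) * R := by
    rw [hb, Real.sqrt_le_left (by positivity), mul_pow, Real.sq_sqrt (by positivity)]
    nlinarith
  calc (S.card : ℝ) ≤ K * (b + K) * (b - a + K) := h1
    _ = K * (b * (b - a) + K * (2 * b - a) + K ^ 2) := by ring
    _ ≤ K * (R + K * (2 * (√(T + 1) * R)) + K ^ 2 * R) := by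
        have h4 : 2 * b - a ≤ 2 * (√(T + 1) * R) := by linarith
        have h5 : K ^ 2 ≤ K ^ 2 * R := le_mul_of_one_le_right (by positivity) hR.le
        gcongr
    _ = _ := by ring

/-- Sorting by `k = ⌊|t - Y| / R⌋₊` gives two annuli with `O(R)` points each, on which the summand
is `O(1 / (k + 1) ^ 2)`. -/
lemma sum_tail_le (A B T : ℝ) (hA : 0 < A) (hB : 0 < B) (hT : 0 < T) :
    ∃ C : ℝ, 0 ≤ C ∧ ∀ (R Y γ δ : ℝ) (S : Finset (ℕ × ℕ)), 1 < R →
      (∀ n ∈ S, diagForm A B γ δ n ≤ T * R ^ 2) →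
      ∑ n ∈ S, 2 / (1 + ((diagForm A B γ δ n - Y) / R) ^ 2) ≤ C * R := by
  obtain ⟨K, hK, hshell⟩ := card_diagForm_shell_le A B T hA hB hT
  have hsum : Summable fun k : ℕ => 4 / ((k + 1 : ℕ) : ℝ) ^ 2 := by
    have := (summable_nat_add_iff 1).mpr (Real.summable_one_div_nat_pow.mpr one_lt_two)
    simpa [div_eq_mul_inv] using this.mul_left 4
  set Z := ∑' k : ℕ, 4 / ((k + 1 : ℕ) : ℝ) ^ 2 with hZ
  have hZ0 : 0 ≤ Z := tsum_nonneg fun k => by positivity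
  refine ⟨2 * K * Z, by positivity, fun R Y γ δ S hR hST => ?_⟩
  have hR0 : 0 < R := by linarith
  classical
  set t := diagForm A B γ δ with ht
  set g : ℕ × ℕ → ℕ := fun n => ⌊|t n - Y| / R⌋₊ with hg
  have hgle : ∀ n, (g n : ℝ) * R ≤ |t n - Y| := fun n => by
    rw [← le_div_iff₀ hR0]; exact Nat.floor_le (by positivity)
  have hglt : ∀ n, |t n - Y| ≤ (g n + 1) * R := fun n => by
    rw [← div_le_iff₀ hR0]; exact (Nat.lt_floor_add_one _).le
  have hterm : ∀ n, 2 / (1 + ((t n - Y) / R) ^ 2) ≤ 4 / ((g n + 1 : ℕ) : ℝ) ^ 2 := by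
    intro n
    have h1 : ((g n : ℝ)) ^ 2 ≤ ((t n - Y) / R) ^ 2 := by
      rw [← sq_abs ((t n - Y) / R), abs_div, abs_of_pos hR0]
      gcongr
      exact Nat.floor_le (by positivity)
    rw [div_le_div_iff₀ (by positivity) (by positivity)]
    push_cast
    nlinarith [sq_nonneg ((g n : ℝ) - 1)]
  have hcard : ∀ k : ℕ, ((S.filter fun n => g n = k).card : ℝ) ≤ 2 * K * R := by
    intro k
    set S₁ := S.filter fun n => Y + k * R ≤ t n ∧ t n ≤ Y + k * R + R with hS₁
    set S₂ := S.filter fun n => Y - (k + 1) * R ≤ t n ∧ t n ≤ Y - (k + 1) * R + R with hS₂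
    have hsub : (S.filter fun n => g n = k) ⊆ S₁ ∪ S₂ := by
      intro n hn
      rw [Finset.mem_filter] at hn
      have h1 := hgle n
      have h2 := hglt n
      rw [hn.2] at h1 h2
      rw [Finset.mem_union, hS₁, hS₂, Finset.mem_filter, Finset.mem_filter]
      rcases abs_cases (t n - Y) with ⟨h3, h4⟩ | ⟨h3, h4⟩
      · left; rw [h3] at h1 h2
        exact ⟨hn.1, by linarith, by linarith⟩
      · right; rw [h3] at h1 h2
        exact ⟨hn.1, by linarith, by linarith⟩
    have h1 := hshell R (Y + k * R) γ δ S₁ hR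
      (fun n hn => hST n (Finset.mem_filter.mp hn).1) fun n hn => (Finset.mem_filter.mp hn).2
    have h2 := hshell R (Y - (k + 1) * R) γ δ S₂ hR
      (fun n hn => hST n (Finset.mem_filter.mp hn).1) fun n hn => (Finset.mem_filter.mp hn).2
    have h3 : ((S.filter fun n => g n = k).card : ℝ) ≤ S₁.card + S₂.card := by
      exact_mod_cast (Finset.card_le_card hsub).trans (Finset.card_union_le _ _)
    linarith
  calc ∑ n ∈ S, 2 / (1 + ((t n - Y) / R) ^ 2) ≤ ∑ n ∈ S, 4 / ((g n + 1 : ℕ) : ℝ) ^ 2 :=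
        Finset.sum_le_sum fun n _ => hterm n
    _ = ∑ k ∈ S.image g, ∑ n ∈ S with g n = k, 4 / ((g n + 1 : ℕ) : ℝ) ^ 2 :=
        (Finset.sum_fiberwise_of_maps_to (fun n hn => Finset.mem_image_of_mem g hn) _).symm
    _ = ∑ k ∈ S.image g, ((S.filter fun n => g n = k).card : ℝ) * (4 / ((k + 1 : ℕ) : ℝ) ^ 2) := by
        refine Finset.sum_congr rfl fun k _ => ?_
        rw [Finset.sum_congr rfl (g := fun _ => 4 / ((k + 1 : ℕ) : ℝ) ^ 2), Finset.sum_const,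
          nsmul_eq_mul]
        intro n hn
        rw [(Finset.mem_filter.mp hn).2]
    _ ≤ ∑ k ∈ S.image g, 2 * K * R * (4 / ((k + 1 : ℕ) : ℝ) ^ 2) :=
        Finset.sum_le_sum fun k _ => mul_le_mul_of_nonneg_right (hcard k) (by positivity)
    _ ≤ 2 * K * R * Z := by
        rw [← Finset.mul_sum]
        gcongr
        exact hsum.sum_le_tsum _ fun k _ => by positivity
    _ = _ := by ring

/-- The sawtooth function of `(X - t) / R`, cut off at `t = X`. -/
def cutSawtooth (R X t : ℝ) : ℝ := if t ≤ X then sawtooth ((X - t) / R) else 0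

lemma cutSawtooth_sum_box_le (A B c₀ C₁ T ε : ℝ) (hA : 0 < A) (hB : 0 < B) (hc₀ : 0 < c₀)
    (hC₁ : 0 < C₁) (hT : 0 < T) (hε : 0 < ε) (hε1 : ε < 1) :
    ∃ C : ℝ, 0 ≤ C ∧ ∀ (R X γ δ : ℝ) (L : ℕ), 1 < R → 0 ≤ X → X ≤ c₀ * R ^ 2 → L ≤ C₁ * R →
      (∀ n ∈ Finset.range L ×ˢ Finset.range L, diagForm A B γ δ n ≤ T * R ^ 2) →
      |∑ n ∈ Finset.range L ×ˢ Finset.range L, cutSawtooth R X (diagForm A B γ δ n)|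
        ≤ C * R ^ (1 + 5 * ε) := by
  obtain ⟨C₂, hC₂, hsmooth⟩ := smooth_sawtooth_sum_le A B c₀ C₁ ε hA hB hc₀ hC₁ hε hε1
  obtain ⟨C₃, hC₃, htail⟩ := sum_tail_le A B T hA hB hT
  refine ⟨C₂ + C₃, by positivity, fun R X γ δ L hR hX hXR hL hbox => ?_⟩
  have hR0 : 0 < R := by linarith
  set s := Finset.range L ×ˢ Finset.range L with hs
  set t := diagForm A B γ δ with ht
  have ht0 : ∀ n, 0 ≤ t n := fun n => by rw [ht]; unfold diagForm; positivity
  have h1 := hsmooth R X γ δ L hR hX hXR hL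
  have h2 := htail R X γ δ s hR hbox
  have h3 := htail R 0 γ δ s hR hbox
  simp only [sub_zero] at h3
  have hterm : ∀ n, |cutSawtooth R X (t n) - smoothCutoff R X (t n) * sawtooth ((X - t n) / R)|
      ≤ (2 / (1 + ((t n - X) / R) ^ 2) + 2 / (1 + (t n / R) ^ 2)) * (1 / 2) := by
    intro n
    have h4 := abs_indicator_sub_smoothCutoff_le hR0 hX (ht0 n)
    have h5 : cutSawtooth R X (t n) - smoothCutoff R X (t n) * sawtooth ((X - t n) / R)
        = ((if t n ≤ X then 1 else 0) - smoothCutoff R X (t n)) * sawtooth ((X - t n) / R) := by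
      unfold cutSawtooth
      split_ifs <;> ring
    rw [h5, abs_mul]
    exact mul_le_mul h4 (abs_sawtooth_le _) (abs_nonneg _) (by positivity)
  have hdiff : |∑ n ∈ s, cutSawtooth R X (t n) -
      ∑ n ∈ s, smoothCutoff R X (t n) * sawtooth ((X - t n) / R)| ≤ C₃ * R := by
    rw [← Finset.sum_sub_distrib]
    calc _ ≤ ∑ n ∈ s, (2 / (1 + ((t n - X) / R) ^ 2) + 2 / (1 + (t n / R) ^ 2)) * (1 / 2) :=
          (Finset.abs_sum_le_sum_abs _ _).trans (Finset.sum_le_sum fun n _ => hterm n)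
      _ ≤ C₃ * R := by
          rw [← Finset.sum_mul, Finset.sum_add_distrib]
          linarith
  have h6 : R ≤ R ^ (1 + 5 * ε) := by
    conv_lhs => rw [← Real.rpow_one R]
    exact Real.rpow_le_rpow_of_exponent_le hR.le (by linarith)
  have h7 : C₃ * R ≤ C₃ * R ^ (1 + 5 * ε) := by gcongr
  have h8 := abs_sub_abs_le_abs_sub (∑ n ∈ s, cutSawtooth R X (t n))
    (∑ n ∈ s, smoothCutoff R X (t n) * sawtooth ((X - t n) / R))
  linarith

/-- The discrepancy bound for a binary diagonal form. -/
lemma binary_sawtooth_sum_le (A B c₀ ε : ℝ) (hA : 0 < A) (hB : 0 < B) (hc₀ : 0 < c₀)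
    (hε : 0 < ε) (hε1 : ε < 1) :
    ∃ C : ℝ, 0 ≤ C ∧ ∀ R X γ δ : ℝ, 1 < R → X ≤ c₀ * R ^ 2 →
      |∑' n : ℤ × ℤ, cutSawtooth R X (A * (n.1 + γ) ^ 2 + B * (n.2 + δ) ^ 2)|
        ≤ C * R ^ (1 + 5 * ε) := by
  set m := min A B with hm
  have hm0 : 0 < m := lt_min hA hB
  have hmA : m ≤ A := min_le_left _ _
  have hmB : m ≤ B := min_le_right _ _
  set c := √(c₀ / m) with hc
  have hc2 : c ^ 2 = c₀ / m := Real.sq_sqrt (by positivity)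
  have hc0 : 0 < c := Real.sqrt_pos.mpr (by positivity)
  -- The ellipse has half-widths at most `c * R`. The square box of integral points covering it
  -- sticks out by at most `1`, so its shifted coordinates stay below `(c + 2) * R` in absolute
  -- value.
  obtain ⟨C, hC, hbound⟩ := cutSawtooth_sum_box_le A B c₀ (2 * c + 1) ((A + B) * (c + 2) ^ 2) ε
    hA hB hc₀ (by positivity) (by positivity) hε hε1
  refine ⟨C, hC, fun R X γ δ hR hXR => ?_⟩
  have hR0 : 0 < R := by linarith
  rcases lt_or_ge X 0 with hX | hX
  · have : ∀ n : ℤ × ℤ, cutSawtooth R X (A * (n.1 + γ) ^ 2 + B * (n.2 + δ) ^ 2) = 0 := by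
      intro n
      apply if_neg
      have : 0 ≤ A * (n.1 + γ) ^ 2 + B * (n.2 + δ) ^ 2 := by positivity
      linarith
    simp only [this, tsum_zero, abs_zero]
    positivity
  set L := ⌊2 * c * R⌋₊ + 1 with hL
  have hLR : (L : ℝ) ≤ (2 * c + 1) * R := by
    rw [hL]; push_cast
    have := Nat.floor_le (show 0 ≤ 2 * c * R by positivity)
    linarith
  set x₀ := ⌈-γ - c * R⌉ with hx₀
  set y₀ := ⌈-δ - c * R⌉ with hy₀
  set e : ℕ × ℕ → ℤ × ℤ := fun n => (x₀ + n.1, y₀ + n.2) with he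
  have hinj : Function.Injective e := by
    intro n k h
    simp only [he, Prod.mk.injEq, add_right_inj, Nat.cast_inj] at h
    exact Prod.ext h.1 h.2
  have hval : ∀ n, A * ((e n).1 + γ) ^ 2 + B * ((e n).2 + δ) ^ 2
      = diagForm A B (x₀ + γ) (y₀ + δ) n := by
    intro n
    simp only [he, diagForm]
    push_cast
    ring
  have hloc : ∀ (a : ℤ) (γ : ℝ), |(a : ℝ) + γ| ≤ c * R →
      ∃ i ∈ Finset.range L, ⌈-γ - c * R⌉ + (i : ℤ) = a := by
    intro a γ h
    obtain ⟨h1, h2⟩ := abs_le.mp h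
    have h3 : ⌈-γ - c * R⌉ ≤ a := by rw [Int.ceil_le]; linarith
    refine ⟨(a - ⌈-γ - c * R⌉).toNat, ?_, by rw [Int.toNat_of_nonneg (by linarith)]; ring⟩
    rw [Finset.mem_range, hL, Nat.lt_succ_iff, Nat.le_floor_iff (by positivity)]
    have h4 : (((a - ⌈-γ - c * R⌉).toNat : ℤ) : ℝ) = a - ⌈-γ - c * R⌉ := by
      rw [Int.toNat_of_nonneg (by linarith)]; push_cast; ring
    rw [← Int.cast_natCast, h4]
    linarith [Int.le_ceil (-γ - c * R)]
  have hcoord : ∀ v w D E : ℝ, m ≤ D → 0 ≤ E * w ^ 2 → D * v ^ 2 + E * w ^ 2 ≤ X → |v| ≤ c * R := by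
    intro v w D E hD hE h
    apply abs_le_of_sq_le_sq _ (by positivity)
    rw [mul_pow, hc2, div_mul_eq_mul_div, le_div_iff₀ hm0]
    nlinarith [sq_nonneg v]
  have hsupp : ∀ n ∉ (Finset.range L ×ˢ Finset.range L).image e,
      cutSawtooth R X (A * (n.1 + γ) ^ 2 + B * (n.2 + δ) ^ 2) = 0 := by
    intro n hn
    apply if_neg
    intro h
    apply hn
    obtain ⟨i, hi, hi'⟩ := hloc n.1 γ (hcoord (n.1 + γ) (n.2 + δ) A B hmA (by positivity) h)
    obtain ⟨j, hj, hj'⟩ := hloc n.2 δ (hcoord (n.2 + δ) (n.1 + γ) B A hmB (by positivity) (by linarith))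
    rw [Finset.mem_image]
    exact ⟨(i, j), Finset.mem_product.mpr ⟨hi, hj⟩, Prod.ext hi' hj'⟩
  rw [tsum_eq_sum hsupp, Finset.sum_image fun a _ b _ h => hinj h]
  simp_rw [hval]
  refine hbound R X (x₀ + γ) (y₀ + δ) L hR hX hXR hLR fun n hn => ?_
  rw [Finset.mem_product, Finset.mem_range, Finset.mem_range, hL] at hn
  have hsq : ∀ (i : ℕ) (γ : ℝ), i < ⌊2 * c * R⌋₊ + 1 →
      ((i : ℝ) + (⌈-γ - c * R⌉ + γ)) ^ 2 ≤ ((c + 2) * R) ^ 2 := by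
    intro i γ hi
    have h1 : (i : ℝ) ≤ 2 * c * R := (Nat.le_floor_iff (by positivity)).mp (Nat.lt_succ_iff.mp hi)
    have h2 := Int.le_ceil (-γ - c * R)
    have h3 := Int.ceil_lt_add_one (-γ - c * R)
    have h4 : (0 : ℝ) ≤ i := by positivity
    apply sq_le_sq'
    · nlinarith
    · nlinarith
  have h1 := hsq n.1 γ hn.1
  have h2 := hsq n.2 δ hn.2
  rw [diagForm]
  calc _ ≤ A * ((c + 2) * R) ^ 2 + B * ((c + 2) * R) ^ 2 := by gcongr
    _ = _ := by ring

/-! ### Reduction of the general form to binary ones by a rational shear -/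

/-- The part of the form that is constant on a plane is absorbed into the threshold, which may
thereby become negative. -/
lemma cutSawtooth_add (R X t r : ℝ) : cutSawtooth R X (t + r) = cutSawtooth R (X - r) t := by
  unfold cutSawtooth
  simp only [le_sub_iff_add_le, sub_add_eq_sub_sub, sub_right_comm X t r]

/-- Completing the square in two linearly independent directions. -/
lemma exists_complete_square {V : Type*} [AddCommGroup V] [Module ℝ V] {Q : QuadraticForm ℝ V}
    (hQ : Q.PosDef) {e f : V} (ρ : ℝ) (he : e ≠ 0) (hf : f - ρ • e ≠ 0)
    (hρ : QuadraticMap.associated (R := ℝ) Q e f = ρ * Q e) :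
    ∃ A B : ℝ, 0 < A ∧ 0 < B ∧ ∃ φ ψ r : V → ℝ, (∀ z, 0 ≤ r z) ∧ ∀ (s t : ℝ) (z : V),
      Q (s • e + t • f + z) = A * (s + ρ * t + φ z) ^ 2 + B * (t + ψ z) ^ 2 + r z := by
  set b := QuadraticMap.associated (R := ℝ) Q with hb
  have hbQ : ∀ x, b x x = Q x := fun x => QuadraticMap.associated_eq_self_apply ℝ Q x
  have hsymm : ∀ x y, b x y = b y x := fun x y => by
    simp only [hb, QuadraticMap.associated_apply, add_comm x y, sub_right_comm]
  set g := f - ρ • e with hg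
  have hA : 0 < Q e := hQ e he
  have hB : 0 < Q g := hQ g hf
  have heg : b e g = 0 := by
    rw [hg, map_sub, map_smul, hρ, hbQ, smul_eq_mul, sub_self]
  refine ⟨Q e, Q g, hA, hB, fun z => b e z / Q e, fun z => b g z / Q g,
    fun z => Q (z - (b e z / Q e) • e - (b g z / Q g) • g), fun z => hQ.nonneg _, fun s t z => ?_⟩
  have hx : s • e + t • f + z = (s + ρ * t) • e + t • g + z := by
    rw [hg]; module
  rw [hx]
  simp only [← hbQ (_ + _ + _), ← hbQ (_ - _ - _), map_add, map_sub, map_smul, LinearMap.add_apply,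
    LinearMap.sub_apply, LinearMap.smul_apply, smul_eq_mul, heg, hsymm g e, hbQ, hsymm z e, hsymm z g]
  field_simp
  ring

/-- Coordinates on `ℤ^(m+2)` in which the first two entries are sheared by `p / q`, after fixing the
residue modulo `q` of the second one. -/
def shearEquiv (m : ℕ) (p : ℤ) (q : ℕ) [NeZero q] :
    (Fin m → ℤ) × (Fin q × (ℤ × ℤ)) ≃ (Fin (m + 2) → ℤ) where
  toFun w := Fin.cons (w.2.2.1 - p * w.2.2.2)
    (Fin.cons ((Int.divModEquiv q).symm (w.2.2.2, w.2.1)) w.1)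
  invFun n := (Fin.tail (Fin.tail n), ((Int.divModEquiv q (n 1)).2,
    (n 0 + p * (Int.divModEquiv q (n 1)).1, (Int.divModEquiv q (n 1)).1)))
  left_inv w := by
    obtain ⟨y, j, u, v⟩ := w
    have h1 : (Fin.cons (u - p * v) (Fin.cons ((Int.divModEquiv q).symm (v, j)) y) :
        Fin (m + 2) → ℤ) 1 = (Int.divModEquiv q).symm (v, j) := rfl
    simp only [h1, Equiv.apply_symm_apply, Fin.cons_zero, Fin.tail_cons, sub_add_cancel]
  right_inv n := by
    simp only [add_sub_cancel_right, Prod.mk.eta, Equiv.symm_apply_apply]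
    ext i
    refine Fin.cases rfl (fun i => ?_) i
    refine Fin.cases rfl (fun i => rfl) i

lemma shearEquiv_apply_add {m : ℕ} (p : ℤ) (q : ℕ) [NeZero q] (α : Fin (m + 2) → ℝ)
    (w : (Fin m → ℤ) × (Fin q × (ℤ × ℤ))) :
    (fun i => (shearEquiv m p q w i : ℝ)) + α =
      ((w.2.2.1 : ℝ) - p * w.2.2.2) • Pi.single 0 1 +
      ((w.2.2.2 : ℝ) * q + (w.2.1 : ℕ)) • Pi.single 1 1 +
      ((Fin.cons 0 (Fin.cons 0 fun i => (w.1 i : ℝ)) : Fin (m + 2) → ℝ) + α) := by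
  obtain ⟨y, j, u, v⟩ := w
  ext i
  refine Fin.cases ?_ (fun i => ?_) i
  · simp [shearEquiv]
  · refine Fin.cases ?_ (fun i => ?_) i
    · simp [shearEquiv]
    · have h0 : i.succ.succ ≠ 0 := Fin.succ_ne_zero _
      have h1 : i.succ.succ ≠ 1 := fun h => Fin.succ_ne_zero i (Fin.succ_injective _ h)
      simp [shearEquiv, h0, h1]

/-- The number of integer points in a box of side `2 * K * R` grows at most like its volume. -/
lemma exists_box_finset (m : ℕ) (K : ℝ) (hK : 0 ≤ K) (R : ℝ) (hR : 1 < R) (α : Fin m → ℝ) :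
    ∃ S : Finset (Fin m → ℤ), (S.card : ℝ) ≤ ((2 * K + 1) * R) ^ m ∧
      ∀ y : Fin m → ℤ, (∀ i, |(y i : ℝ) + α i| ≤ K * R) → y ∈ S := by
  have hR0 : 0 < R := by linarith
  refine ⟨Fintype.piFinset fun i => Finset.Icc ⌈-α i - K * R⌉ ⌊-α i + K * R⌋, ?_, fun y hy => ?_⟩
  · rw [Fintype.card_piFinset, Nat.cast_prod]
    calc _ ≤ ∏ _i : Fin m, (2 * K + 1) * R := by
          refine Finset.prod_le_prod (fun i _ => by positivity) fun i _ => ?_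
          rw [Int.card_Icc]
          have h1 := Int.floor_le (-α i + K * R)
          have h2 := Int.le_ceil (-α i - K * R)
          have h3 : 0 ≤ (2 * K + 1) * R := by positivity
          rcases le_total 0 (⌊-α i + K * R⌋ + 1 - ⌈-α i - K * R⌉) with h | h
          · rw [← Int.cast_natCast, Int.toNat_of_nonneg h]
            push_cast
            linarith
          · rw [Int.toNat_of_nonpos h]
            simpa using h3
      _ = _ := by simp
  · rw [Fintype.mem_piFinset]
    intro i
    obtain ⟨h1, h2⟩ := abs_le.mp (hy i)
    rw [Finset.mem_Icc, Int.ceil_le, Int.le_floor]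
    constructor <;> linarith

/-- The discrepancy bound for a form in at least two variables whose first two basis vectors span a
plane on which the form is diagonalised by a rational shear. -/
lemma sawtooth_sum_le {m : ℕ} {Q : QuadraticForm ℝ (Fin (m + 2) → ℝ)} (hQ : Q.PosDef) (ρ : ℚ)
    (hρ : QuadraticMap.associated (R := ℝ) Q (Pi.single 0 1) (Pi.single 1 1)
      = ρ * Q (Pi.single 0 1)) (c₀ ε : ℝ) (hc₀ : 0 < c₀) (hε : 0 < ε) (hε1 : ε < 1) :
    ∃ C : ℝ, 0 ≤ C ∧ ∀ (R X : ℝ) (α : Fin (m + 2) → ℝ), 1 < R → X ≤ c₀ * R ^ 2 →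
      |∑' n : Fin (m + 2) → ℤ, cutSawtooth R X (Q ((fun i => (n i : ℝ)) + α))|
        ≤ C * R ^ (m + 1 + 5 * ε) := by
  have he : (Pi.single 0 1 : Fin (m + 2) → ℝ) ≠ 0 := fun h => by simpa using congrFun h 0
  have hf : (Pi.single 1 1 : Fin (m + 2) → ℝ) - (ρ : ℝ) • Pi.single 0 1 ≠ 0 := fun h => by
    simpa using congrFun h 1
  obtain ⟨A, B, hA, hB, φ, ψ, r, hr, hsq⟩ := exists_complete_square hQ ρ he hf hρ
  obtain ⟨c, hc, hlow⟩ := exists_le_quadraticForm hQ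
  set p := ρ.num with hp
  set q := ρ.den with hq
  have : NeZero q := ⟨ρ.den_ne_zero⟩
  have hq0 : (0 : ℝ) < q := by exact_mod_cast ρ.pos
  have hρq : (ρ : ℝ) = p / q := by rw [hp, hq]; exact_mod_cast (Rat.num_div_den ρ).symm
  -- With `s = u - p * v` and `t = q * v + j` one has `s + ρ * t = u + ρ * j`, so `v` leaves the
  -- first square and enters the second with coefficient `q`.
  obtain ⟨C, hC, hbin⟩ := binary_sawtooth_sum_le A (B * q ^ 2) c₀ ε hA (by positivity) hc₀ hε hε1
  set K := √(c₀ / c) with hK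
  have hK2 : K ^ 2 = c₀ / c := Real.sq_sqrt (by positivity)
  refine ⟨(2 * K + 1) ^ m * (q * C), by positivity, fun R X α hR hX => ?_⟩
  have hR0 : 0 < R := by linarith
  set F : (Fin (m + 2) → ℤ) → ℝ := fun n => cutSawtooth R X (Q ((fun i => (n i : ℝ)) + α)) with hF
  have hFsupp : ∀ n, F n ≠ 0 → Q ((fun i => (n i : ℝ)) + α) ≤ X := fun n hn => by
    by_contra h
    exact hn (if_neg h)
  have hsumF : Summable F := summable_of_hasFiniteSupport <|
    (finite_setOf_quadraticForm_le hQ α X).subset hFsupp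
  have hsum := (shearEquiv m p q).summable_iff.mpr hsumF
  have htotal : ∑' n, F n = ∑' y, ∑' w, F (shearEquiv m p q (y, w)) := by
    rw [← (shearEquiv m p q).tsum_eq]
    exact hsum.tsum_prod
  change |∑' n, F n| ≤ _
  rw [htotal]
  obtain ⟨S, hScard, hS⟩ := exists_box_finset m K (Real.sqrt_nonneg _) R hR fun i => α i.succ.succ
  have hslice : ∀ y, |∑' w, F (shearEquiv m p q (y, w))| ≤ q * C * R ^ (1 + 5 * ε) := by
    intro y
    have h1 : Summable fun w => F (shearEquiv m p q (y, w)) := hsum.prod_factor y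
    rw [h1.tsum_prod, tsum_fintype]
    set z : Fin (m + 2) → ℝ := (Fin.cons 0 (Fin.cons 0 fun i => (y i : ℝ)) : Fin (m + 2) → ℝ) + α
    calc _ ≤ ∑ j : Fin q, |∑' n : ℤ × ℤ, F (shearEquiv m p q (y, j, n))| :=
          Finset.abs_sum_le_sum_abs _ _
      _ ≤ ∑ _j : Fin q, C * R ^ (1 + 5 * ε) := by
          refine Finset.sum_le_sum fun j _ => ?_
          have h2 : ∀ n : ℤ × ℤ, F (shearEquiv m p q (y, j, n)) = cutSawtooth R (X - r z)
              (A * (n.1 + (ρ * (j : ℕ) + φ z)) ^ 2 + B * q ^ 2 * (n.2 + ((j : ℕ) + ψ z) / q) ^ 2) := by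
            intro n
            rw [hF, ← cutSawtooth_add]
            simp only [shearEquiv_apply_add, hsq]
            congr 1
            rw [hρq]
            field_simp
            ring
          simp_rw [h2]
          exact hbin R (X - r z) _ _ hR (by linarith [hr z])
      _ = _ := by simp [mul_assoc]
  have hzero : ∀ y ∉ S, ∑' w, F (shearEquiv m p q (y, w)) = 0 := by
    intro y hy
    have : ∀ w, F (shearEquiv m p q (y, w)) = 0 := by
      intro w
      by_contra h
      refine hy (hS y fun i => ?_)
      apply abs_le_of_sq_le_sq _ (by positivity)
      have h1 := (hlow _).trans ((hFsupp _ h).trans hX)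
      have h2 := norm_le_pi_norm ((fun i => (shearEquiv m p q (y, w) i : ℝ)) + α) i.succ.succ
      have h3 : ((fun i => (shearEquiv m p q (y, w) i : ℝ)) + α) i.succ.succ
          = y i + α i.succ.succ := rfl
      rw [h3, Real.norm_eq_abs] at h2
      rw [mul_pow, hK2, div_mul_eq_mul_div, le_div_iff₀ hc, ← sq_abs]
      have h4 := pow_le_pow_left₀ (abs_nonneg _) h2 2
      nlinarith
    simp only [this, tsum_zero]
  rw [tsum_eq_sum hzero]
  calc _ ≤ ∑ y ∈ S, |∑' w, F (shearEquiv m p q (y, w))| := Finset.abs_sum_le_sum_abs _ _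
    _ ≤ S.card * (q * C * R ^ (1 + 5 * ε)) := by
        rw [← nsmul_eq_mul]
        exact Finset.sum_le_card_nsmul _ _ _ fun y _ => hslice y
    _ ≤ ((2 * K + 1) * R) ^ m * (q * C * R ^ (1 + 5 * ε)) := by gcongr
    _ = _ := by
        rw [add_assoc (m : ℝ), Real.rpow_add hR0 m, Real.rpow_natCast, mul_pow]
        ring

/-! ### The lattice point count and the volume of the paraboloid -/

lemma mem_latticePoints_paraboloid {m : ℕ} (Q : QuadraticForm ℝ (Fin m → ℝ)) {R : ℝ} (hR : 0 < R)
    (c : ℝ) (β : Fin m → ℝ) (n : (Fin m → ℤ) × ℤ) :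
    n ∈ latticePoints (paraboloid Q c β) R ↔
      |(n.2 : ℝ)| ≤ (c * R ^ 2 - Q ((fun i => (n.1 i : ℝ)) + R • β)) / R := by
  have h1 : R⁻¹ • (fun i => (n.1 i : ℝ)) + β = R⁻¹ • ((fun i => (n.1 i : ℝ)) + R • β) := by
    rw [smul_add, inv_smul_smul₀ hR.ne']
  change |R⁻¹ * (n.2 : ℝ)| ≤ c - Q (R⁻¹ • (fun i => (n.1 i : ℝ)) + β) ↔ _
  rw [h1, QuadraticMap.map_smul, smul_eq_mul, abs_mul, abs_of_pos (inv_pos.mpr hR), le_div_iff₀ hR,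
    inv_mul_le_iff₀ hR]
  have h2 : R * (c - R⁻¹ * R⁻¹ * Q ((fun i => (n.1 i : ℝ)) + R • β)) * R
      = c * R ^ 2 - Q ((fun i => (n.1 i : ℝ)) + R • β) := by
    field_simp
  rw [← h2, mul_le_mul_iff_left₀ hR]

/-- Counting lattice points fibrewise over the base. -/
lemma latticeCount_paraboloid {m : ℕ} (Q : QuadraticForm ℝ (Fin m → ℝ)) {R : ℝ} (hR : 0 < R)
    (c : ℝ) (β : Fin m → ℝ) (S : Finset (Fin m → ℤ))
    (hS : ∀ n, n ∈ S ↔ Q ((fun i => (n i : ℝ)) + R • β) ≤ c * R ^ 2) :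
    (latticeCount (paraboloid Q c β) R : ℝ) =
      2 / R * ∑ n ∈ S, (c * R ^ 2 - Q ((fun i => (n i : ℝ)) + R • β)) -
      2 * ∑' n : Fin m → ℤ, cutSawtooth R (c * R ^ 2) (Q ((fun i => (n i : ℝ)) + R • β)) := by
  set s : (Fin m → ℤ) → ℝ := fun n => (c * R ^ 2 - Q ((fun i => (n i : ℝ)) + R • β)) / R with hs
  have hs0 : ∀ n, n ∈ S ↔ 0 ≤ s n := fun n => by
    rw [hS, hs, le_div_iff₀ hR, zero_mul, sub_nonneg]
  have hset : latticePoints (paraboloid Q c β) R =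
      Equiv.sigmaEquivProd (Fin m → ℤ) ℤ '' ↑(S.sigma fun n => Finset.Icc (-⌊s n⌋) ⌊s n⌋) := by
    ext ⟨n, k⟩
    rw [mem_latticePoints_paraboloid Q hR, Equiv.image_eq_preimage_symm, Set.mem_preimage,
      Finset.mem_coe, Finset.mem_sigma, Finset.mem_Icc, hs0]
    change |(k : ℝ)| ≤ s n ↔ 0 ≤ s n ∧ -⌊s n⌋ ≤ k ∧ k ≤ ⌊s n⌋
    rw [← abs_le, Int.le_floor, Int.cast_abs]
    exact ⟨fun h => ⟨(abs_nonneg _).trans h, h⟩, fun h => h.2⟩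
  have htsum : ∑' n : Fin m → ℤ, cutSawtooth R (c * R ^ 2) (Q ((fun i => (n i : ℝ)) + R • β))
      = ∑ n ∈ S, sawtooth (s n) := by
    have hzero : ∀ n ∉ S,
        cutSawtooth R (c * R ^ 2) (Q ((fun i => (n i : ℝ)) + R • β)) = 0 := fun n hn =>
      if_neg fun h => hn ((hS n).mpr h)
    rw [tsum_eq_sum hzero]
    exact Finset.sum_congr rfl fun n hn => if_pos ((hS n).mp hn)
  rw [htsum, latticeCount, hset, Set.ncard_image_of_injective _ (Equiv.injective _),
    Set.ncard_coe_finset, Finset.card_sigma, Nat.cast_sum, Finset.mul_sum, Finset.mul_sum,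
    ← Finset.sum_sub_distrib]
  refine Finset.sum_congr rfl fun n hn => ?_
  have h0 : 0 ≤ ⌊s n⌋ := Int.floor_nonneg.mpr ((hs0 n).mp hn)
  have h1 : 2 / R * (c * R ^ 2 - Q ((fun i => (n i : ℝ)) + R • β)) = 2 * s n := by
    rw [hs]; ring
  -- The fibre has `2 * ⌊s n⌋ + 1` points, which equals `2 * s n - 2 * sawtooth (s n)`.
  have h2 := Int.floor_add_fract (s n)
  rw [h1, Int.card_Icc, ← Int.cast_natCast, Int.toNat_of_nonneg (by linarith), sawtooth]
  push_cast
  linarith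

lemma volume_real_paraboloid {m : ℕ} {Q : QuadraticForm ℝ (Fin m → ℝ)} (c : ℝ) (β : Fin m → ℝ) :
    volume.real (paraboloid Q c β) = 2 * ∫ x, max 0 (c - Q (x + β)) := by
  have hcont : Continuous fun x : Fin m → ℝ => Q (x + β) :=
    (continuous_quadraticForm Q).comp (by fun_prop)
  have hmeas : MeasurableSet (paraboloid Q c β) := by
    refine (isClosed_le (f := fun p : (Fin m → ℝ) × ℝ => |p.2|)
      (g := fun p => c - Q (p.1 + β)) (by fun_prop) ?_).measurableSet
    exact continuous_const.sub (hcont.comp continuous_fst)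
  have hslice : ∀ x, volume (Prod.mk x ⁻¹' paraboloid Q c β)
      = ENNReal.ofReal (2 * max 0 (c - Q (x + β))) := by
    intro x
    have : Prod.mk x ⁻¹' paraboloid Q c β = Set.Icc (-(c - Q (x + β))) (c - Q (x + β)) := by
      ext y
      exact abs_le (a := y)
    rw [this, Real.volume_Icc, sub_neg_eq_add, ← two_mul]
    rcases le_total 0 (c - Q (x + β)) with h | h
    · rw [max_eq_right h]
    · rw [max_eq_left h, mul_zero, ENNReal.ofReal_zero, ENNReal.ofReal_of_nonpos (by linarith)]
  rw [measureReal_def, Measure.volume_eq_prod, Measure.prod_apply hmeas, ← integral_const_mul,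
    integral_eq_lintegral_of_nonneg_ae]
  · simp_rw [hslice]
  · exact Filter.Eventually.of_forall fun x => by positivity
  · exact (continuous_const.mul (continuous_const.max (continuous_const.sub hcont))).aestronglyMeasurable

/-- Under `z = R • x` the Jacobian contributes `R ^ m` and the homogeneity of the integrand `R ^ 2`.
-/
lemma integral_max_sub_smul {m : ℕ} {Q : QuadraticForm ℝ (Fin m → ℝ)} {R : ℝ} (hR : 0 < R) (c : ℝ)
    (β : Fin m → ℝ) :
    ∫ z, max 0 (c * R ^ 2 - Q (z + R • β)) = R ^ (m + 2) * ∫ x, max 0 (c - Q (x + β)) := by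
  have h1 := Measure.integral_comp_smul volume (fun z => max 0 (c * R ^ 2 - Q (z + R • β))) R
  have h2 : ∀ x, max 0 (c * R ^ 2 - Q (R • x + R • β)) = R ^ 2 * max 0 (c - Q (x + β)) := by
    intro x
    rw [← smul_add, QuadraticMap.map_smul, smul_eq_mul, mul_max_of_nonneg _ _ (by positivity)]
    congr 1 <;> ring
  simp_rw [h2] at h1
  rw [integral_const_mul, Module.finrank_fintype_fun_eq_card, Fintype.card_fin, smul_eq_mul,
    abs_of_pos (by positivity), eq_inv_mul_iff_mul_eq₀ (by positivity)] at h1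
  rw [← h1]
  ring

/-- The lattice point count for a paraboloid over a space of dimension at least two, when the form
is diagonalised by a rational shear on the plane of the first two basis vectors. -/
theorem abs_latticeCount_paraboloid_sub_le {m : ℕ} {Q : QuadraticForm ℝ (Fin (m + 2) → ℝ)}
    (hQ : Q.PosDef) (ρ : ℚ) (hρ : QuadraticMap.associated (R := ℝ) Q (Pi.single 0 1)
      (Pi.single 1 1) = ρ * Q (Pi.single 0 1)) (ε c₀ : ℝ) (hε : 0 < ε) (hc₀ : 0 < c₀) :
    ∃ C : ℝ, ∀ (c R : ℝ) (β : Fin (m + 2) → ℝ), 0 < c → c ≤ c₀ → 1 < R →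
      |(latticeCount (paraboloid Q c β) R : ℝ) - volume.real (paraboloid Q c β) * R ^ (m + 3)|
        ≤ C * R ^ (m + 1 + ε) := by
  -- The sawtooth bound loses `5 * δ` in the exponent and requires `δ < 1`.
  set δ := min (ε / 5) (1 / 2) with hδ
  have hδ0 : 0 < δ := lt_min (by positivity) (by norm_num)
  have hδ1 : δ < 1 := (min_le_right _ _).trans_lt (by norm_num)
  have hδε : 5 * δ ≤ ε := by linarith [min_le_left (ε / 5) (1 / 2 : ℝ)]
  obtain ⟨C₁, hC₁, hmean⟩ := riesz_mean_le hQ (k := m + 1) (by simp) c₀ hc₀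
  obtain ⟨C₂, hC₂, hsaw⟩ := sawtooth_sum_le hQ ρ hρ c₀ δ hc₀ hδ0 hδ1
  refine ⟨2 * C₁ + 2 * C₂, fun c R β hc hcc₀ hR => ?_⟩
  have hR0 : 0 < R := by linarith
  have hX : c * R ^ 2 ≤ c₀ * R ^ 2 := by gcongr
  have hfin := finite_setOf_quadraticForm_le hQ (R • β) (c * R ^ 2)
  have hmem : ∀ n, n ∈ hfin.toFinset ↔ Q ((fun i => (n i : ℝ)) + R • β) ≤ c * R ^ 2 :=
    fun n => hfin.mem_toFinset
  have h1 := hmean R (c * R ^ 2) (R • β) hfin.toFinset hR (by positivity) hX hmem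
  have h2 := hsaw R (c * R ^ 2) (R • β) hR hX
  rw [integral_max_sub_smul hR0] at h1
  rw [latticeCount_paraboloid Q hR0 c β _ hmem, volume_real_paraboloid]
  set M := ∑ n ∈ hfin.toFinset, (c * R ^ 2 - Q ((fun i => (n i : ℝ)) + R • β))
  set N := ∑' n : Fin (m + 2) → ℤ, cutSawtooth R (c * R ^ 2) (Q ((fun i => (n i : ℝ)) + R • β))
  set I := ∫ x, max 0 (c - Q (x + β))
  have h3 : 2 / R * M - 2 * N - 2 * I * R ^ (m + 3)
      = 2 / R * (M - R ^ (m + 2 + 2) * I) - 2 * N := by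
    field_simp
    ring
  have h4 : R ^ (m + 1 + 5 * δ) ≤ R ^ (m + 1 + ε) :=
    Real.rpow_le_rpow_of_exponent_le hR.le (by linarith)
  have h5 : R ^ (m + 1) ≤ R ^ (m + 1 + ε) := by
    rw [← Real.rpow_natCast]
    exact Real.rpow_le_rpow_of_exponent_le hR.le (by push_cast; linarith)
  rw [h3]
  calc _ ≤ |2 / R * (M - R ^ (m + 2 + 2) * I)| + |2 * N| := abs_sub _ _
    _ = 2 / R * |M - R ^ (m + 2 + 2) * I| + 2 * |N| := by
        rw [abs_mul, abs_mul, abs_of_pos (by positivity : 0 < 2 / R), abs_two]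
    _ ≤ 2 / R * (C₁ * R ^ (m + 1 + 1)) + 2 * (C₂ * R ^ (m + 1 + 5 * δ)) := by gcongr
    _ = 2 * (C₁ * R ^ (m + 1)) + 2 * (C₂ * R ^ (m + 1 + 5 * δ)) := by
        congr 1
        field_simp
        ring
    _ ≤ 2 * (C₁ * R ^ (m + 1 + ε)) + 2 * (C₂ * R ^ (m + 1 + ε)) := by gcongr
    _ = _ := by ring

end

theorem theorem2 (d : ℕ) (hd : 3 ≤ d)
    (Q : QuadraticForm ℝ (Fin (d - 1) → ℝ)) (hQ : Q.PosDef)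
    (h12 : ∃ q : ℚ, coeffMatrix Q ⟨0, by omega⟩ ⟨1, by omega⟩ /
      coeffMatrix Q ⟨0, by omega⟩ ⟨0, by omega⟩ = (q : ℝ))
    (h22 : ∃ q : ℚ, coeffMatrix Q ⟨1, by omega⟩ ⟨1, by omega⟩ /
      coeffMatrix Q ⟨0, by omega⟩ ⟨0, by omega⟩ = (q : ℝ))
    (ε : ℝ) (hε : 0 < ε) (c₀ : ℝ) (hc₀ : 0 < c₀) :
    ∃ C : ℝ, ∀ (c R : ℝ) (β : Fin (d - 1) → ℝ), 0 < c → c ≤ c₀ → 1 < R →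
      |(latticeCount (paraboloid Q c β) R : ℝ) - volume.real (paraboloid Q c β) * R ^ d|
        ≤ C * R ^ ((d : ℝ) - 2 + ε) := by
  -- Here `d = m + 3`: `m` counts the coordinates outside the plane of the first two basis vectors
  -- and the height, and `d - 2 = m + 1`.
  obtain ⟨m, rfl⟩ := Nat.exists_eq_add_of_le' hd
  change QuadraticForm ℝ (Fin (m + 2) → ℝ) at Q
  obtain ⟨ρ, hρ⟩ := h12
  have hentry : ∀ i j, coeffMatrix Q i j
      = QuadraticMap.associated (R := ℝ) Q (Pi.single i 1) (Pi.single j 1) := fun i j =>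
    LinearMap.toMatrix₂'_apply _ _ _
  have he : (Pi.single 0 1 : Fin (m + 2) → ℝ) ≠ 0 := fun h => by simpa using congrFun h 0
  have hpos : 0 < Q (Pi.single 0 1) := hQ _ he
  have hρ' : QuadraticMap.associated (R := ℝ) Q (Pi.single 0 1) (Pi.single 1 1)
      = ρ * Q (Pi.single 0 1) := by
    have h0 : QuadraticMap.associated (R := ℝ) Q (Pi.single 0 1) (Pi.single 0 1)
      = Q (Pi.single 0 1) := QuadraticMap.associated_eq_self_apply ℝ Q _
    rw [← div_eq_iff hpos.ne', ← hρ, ← h0, ← hentry, ← hentry]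
    rfl
  obtain ⟨C, hC⟩ := abs_latticeCount_paraboloid_sub_le hQ ρ hρ' ε c₀ hε hc₀
  refine ⟨C, fun c R β hc hcc₀ hR => ?_⟩
  have h1 : ((m + 3 : ℕ) : ℝ) - 2 + ε = m + 1 + ε := by push_cast; ring
  rw [h1]
  exact hC c R β hc hcc₀ hR
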